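/- **Setting.** Let $P$ be a probability measure on a measurable space $\mathcal X$, let $X_1,X_2,\dots$ be i.i.d. from $P$, and let $P_n=\frac1n\sum_{i\le n}\delta_{X_i}$ (also identified with the sample $(X_1,\dots,X_n)$). Let $\theta$ be an $\mathbb R^d$-valued functional of distributions, and let $\tilde\theta(\cdot,W_n)$ be a randomized $\mathbb R^d$-valued estimator computed from a sample of size $n$, where the noise $W_n\sim\nu_n$ is independent of the sample; all estimators are measurable functions of the sample (and noise). Let $m=m(n)$ be subsample sizes and $s=s_n=\lfloor n/m\rfloor$. From the $n$ observations one draws $s$ disjoint subsamples $P_m^{(1)},\dots,P_m^{(s)}$ of size $m$, by a (deterministic or random) rule independent of the data. Write $P_m^{\rm sub}$ for one of them, say $P_m^{(1)}$, and $P^*_{m,n}$ for the empirical distribution of $n$ points drawn i.i.d. with replacement from it. "Conditionally almost surely" means: conditionally on the data sequence, for almost every data sequence. For $u,v\in\mathbb R^d$, $v\le u$ is meant coordinatewise. **Procedure.** Let $\alpha\in(0,1)$, $\varepsilon_n>0$ and $I_t=\{u\in\mathbb R^d:\|u\|_2\le t/\sqrt n\}$ for $t=1,\dots,n$. For each subsample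 $i\le s$ and each $t\le n$ let $\hat p_i(t)$ be the proportion, among $N_n$ independent draws of a resample $P^*_{m,n}$ from $P_m^{(i)}$ and of a noise $W\sim\nu_n$, for which $\sqrt n\,(\theta(P_m^{(i)})-\tilde\theta(P^*_{m,n},W))\in I_t$; for $N_n=\infty$ (no Monte Carlo error), $\hat p_i(t)$ is the conditional probability of this event given $P_m^{(i)}$. Draw independently $\xi_0\sim\mathrm{Lap}(s/2,2/\varepsilon_n)$ and $\xi_1,\dots,\xi_n\sim\mathrm{Lap}(0,4/\varepsilon_n)$. Let $\hat t$ be the first $t\in\{1,\dots,n\}$ such that the $\lfloor\xi_0+\xi_t\rfloor$-th smallest of $\hat p_1(t),\dots,\hat p_s(t)$ is at least $1-\alpha$ (this order statistic being read as $-\infty$ if $\xi_0+\xi_t<1$ and as $+\infty$ if $\xi_0+\xi_t>s$). The confidence set is $$C_\alpha(P_n)=\tilde\theta(P_n,W_n)+\tfrac1{\sqrt n}I_{\hat t},$$ where $I_{\hat t}$ is replaced by an arbitrary fixed set if no such $t$ exists. **Theorem.** Assume: 1. $T_n:=\sqrt n(\theta(P)-\theta(P_n))$ converges in distribution to $\mathcal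 N(0,\Sigma)$ with $\Sigma$ positive semidefinite and $\Sigma\neq0$; 2. with $T^*_{m,n}:=\sqrt n(\theta(P_m^{\rm sub})-\theta(P^*_{m,n}))$, one has $\sup_{u\in\mathbb R^d}\bigl|\mathbb P(T_n\le u)-\mathbb P(T^*_{m,n}\le u\mid P_m^{\rm sub})\bigr|\to0$ in probability, conditionally almost surely; 3. $\sqrt n\,(\tilde\theta(P^*_{m,n},W_n)-\theta(P^*_{m,n}))\to0$ in probability, conditionally almost surely, and $\sqrt n\,(\tilde\theta(P_n,W_n)-\theta(P_n))\to0$ in probability; 4. there are $\beta_n>0$ with $\beta_n\to0$ such that $s_n>32\max\{\frac1{\varepsilon_n}\log\frac{8n}{3\beta_n},\ \log\frac{2n}{\beta_n}\}$ for all large $n$; 5. $N_n\to\infty$ (in particular $N_n=\infty$ for all $n$ is allowed). Then $\mathbb P(\theta(P)\in C_\alpha(P_n))\to1-\alpha$ as $n\to\infty$, the probability being over the data and all the randomness of the procedure. -/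

import Mathlib

open MeasureTheory ProbabilityTheory Filter Topology
open scoped ENNReal

noncomputable section

namespace PrivBLB

/-! ### Samples and empirical distributions -/

/-- The empirical distribution `(1/n) ∑ᵢ δ_{yᵢ}` of a sample `y` of size `n`. -/
def empirical {𝒳 : Type*} [MeasurableSpace 𝒳] {n : ℕ} (y : Fin n → 𝒳) : Measure 𝒳 :=
  (n : ℝ≥0∞)⁻¹ • ∑ i, Measure.dirac (y i)

/-- The law of an infinite i.i.d. sequence `X₁, X₂, …` with common law `P`. -/
def dataLaw {𝒳 : Type*} [MeasurableSpace 𝒳] (P : Measure 𝒳) [IsProbabilityMeasure P] :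
    Measure (ℕ → 𝒳) :=
  Measure.infinitePi fun _ : ℕ => P

instance {𝒳 : Type*} [MeasurableSpace 𝒳] (P : Measure 𝒳) [IsProbabilityMeasure P] :
    IsProbabilityMeasure (dataLaw P) := by
  unfold dataLaw; infer_instance

/-- The sample formed by the first `n` observations. -/
def sample {𝒳 : Type*} (n : ℕ) (x : ℕ → 𝒳) : Fin n → 𝒳 := fun i => x i

/-- The centered statistic `√n (θ(P) - θ(Pₙ))`. -/
def centered {𝒳 : Type*} [MeasurableSpace 𝒳] {d : ℕ}
    (θ : Measure 𝒳 → EuclideanSpace ℝ (Fin d)) (P : Measure 𝒳) (n : ℕ) (x : ℕ → 𝒳) :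
    EuclideanSpace ℝ (Fin d) :=
  √(n : ℝ) • (θ P - θ (empirical (sample n x)))

/-! ### Subsamples and resamples -/

/-- A choice of `⌊n/m⌋` pairwise disjoint subsamples of size `m` of the `n` observations:
`(i, j)` is sent to the index of the `j`-th point of the `i`-th subsample. -/
def Splitting (n m : ℕ) : Type := Fin (n / m) × Fin m ↪ Fin n

instance (n m : ℕ) : MeasurableSpace (Splitting n m) := ⊤

/-- The `i`-th subsample. -/
def subsample {𝒳 : Type*} {n m : ℕ} (σ : Splitting n m) (x : ℕ → 𝒳) (i : Fin (n / m)) :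
    Fin m → 𝒳 :=
  fun j => sample n x (σ.toFun (i, j))

/-- The law of `n` i.i.d. uniform indices in `{1, …, m}`, i.e. the uniform law on all index
tuples. If `J` has this law, `y ∘ J` is a resample of size `n`, drawn with replacement from the
`m` points of `y`. -/
def resampleLaw (m n : ℕ) : Measure (Fin n → Fin m) := uniformOn Set.univ

instance (m n : ℕ) : IsFiniteMeasure (resampleLaw m n) := by
  unfold resampleLaw; infer_instance

/-- The bag-of-little-bootstraps statistic `√n (θ(P_m) - θ(P*_{m,n}))`, for the subsample `y`
and the resample `y ∘ J`. -/
def blbStat {𝒳 : Type*} [MeasurableSpace 𝒳] {d : ℕ}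
    (θ : Measure 𝒳 → EuclideanSpace ℝ (Fin d)) {m n : ℕ} (y : Fin m → 𝒳) (J : Fin n → Fin m) :
    EuclideanSpace ℝ (Fin d) :=
  √(n : ℝ) • (θ (empirical y) - θ (empirical (y ∘ J)))

/-- Its private analogue `√n (θ(P_m) - θ̃(P*_{m,n}, W))`. -/
def privBlbStat {𝒳 𝒲 : Type*} [MeasurableSpace 𝒳] {d : ℕ}
    (θ : Measure 𝒳 → EuclideanSpace ℝ (Fin d)) {m n : ℕ}
    (θt : (Fin n → 𝒳) → 𝒲 → EuclideanSpace ℝ (Fin d)) (y : Fin m → 𝒳)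
    (r : (Fin n → Fin m) × 𝒲) : EuclideanSpace ℝ (Fin d) :=
  √(n : ℝ) • (θ (empirical y) - θt (y ∘ r.1) r.2)

/-! ### Consistency notions -/

/-- Kolmogorov–Smirnov distance `sup_u |μ(v ≤ u) - ν(v ≤ u)|`, with the coordinatewise order. -/
def ksDist {d : ℕ} (μ ν : Measure (EuclideanSpace ℝ (Fin d))) : ℝ :=
  ⨆ u : EuclideanSpace ℝ (Fin d), |μ.real {v | ∀ j, v j ≤ u j} - ν.real {v | ∀ j, v j ≤ u j}|

/-- KS-consistency of the bag-of-little-bootstraps statistic: for almost every data sequence,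
conditionally on it (the remaining randomness being the draw of the subsample), the
Kolmogorov–Smirnov distance between the law of `√n (θ(P) - θ(Pₙ))` and the conditional law of the
statistic given its subsample tends to zero in probability. The subsample is the first one of the
splitting; `κ n` is the law by which the splitting is drawn. -/
def KSConsistent {𝒳 : Type*} [MeasurableSpace 𝒳] {d : ℕ}
    (P : Measure 𝒳) [IsProbabilityMeasure P] (θ : Measure 𝒳 → EuclideanSpace ℝ (Fin d))
    (m : ℕ → ℕ) (κ : (n : ℕ) → PMF (Splitting n (m n))) : Prop :=
  ∀ᵐ x ∂(dataLaw P), ∀ δ : ℝ, 0 < δ →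
    Tendsto (fun n : ℕ => (κ n).toMeasure
      {σ | ∃ h : 0 < n / m n,
        δ ≤ ksDist ((dataLaw P).map (centered θ P n))
          ((resampleLaw (m n) n).map (blbStat θ (subsample σ x ⟨0, h⟩)))})
      atTop (𝓝 0)

/-- Rate-`√n` resampling consistency of `θ̃` for `θ`:
`√n (θ̃(P*_{m,n}, Wₙ) - θ(P*_{m,n})) → 0` in probability, conditionally on almost every data
sequence, and `θ̃(Pₙ, Wₙ) - θ(Pₙ) = o_P(1/√n)`. Here `Wₙ ∼ ν n` is independent of everything
else. -/
structure ResamplingConsistent {𝒳 𝒲 : Type*} [MeasurableSpace 𝒳] [MeasurableSpace 𝒲] {d : ℕ}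
    (P : Measure 𝒳) [IsProbabilityMeasure P] (ν : ℕ → Measure 𝒲)
    (θ : Measure 𝒳 → EuclideanSpace ℝ (Fin d))
    (θt : (n : ℕ) → (Fin n → 𝒳) → 𝒲 → EuclideanSpace ℝ (Fin d))
    (m : ℕ → ℕ) (κ : (n : ℕ) → PMF (Splitting n (m n))) : Prop where
  resample : ∀ᵐ x ∂(dataLaw P), ∀ δ : ℝ, 0 < δ →
    Tendsto (fun n : ℕ => ((κ n).toMeasure.prod ((resampleLaw (m n) n).prod (ν n)))
      {r | ∃ h : 0 < n / m n,
        δ ≤ ‖√(n : ℝ) • (θt n (subsample r.1 x ⟨0, h⟩ ∘ r.2.1) r.2.2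
          - θ (empirical (subsample r.1 x ⟨0, h⟩ ∘ r.2.1)))‖})
      atTop (𝓝 0)
  full : ∀ δ : ℝ, 0 < δ →
    Tendsto (fun n : ℕ => ((dataLaw P).prod (ν n))
      {r | δ ≤ ‖√(n : ℝ) • (θt n (sample n r.1) r.2 - θ (empirical (sample n r.1)))‖})
      atTop (𝓝 0)

/-! ### The noisy median above a threshold -/

/-- The Laplace distribution with location `μ` and scale `b`. -/
def laplace (μ b : ℝ) : Measure ℝ :=
  volume.withDensity fun x => ENNReal.ofReal ((2 * b)⁻¹ * Real.exp (-|x - μ| / b))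

instance (μ b : ℝ) : SigmaFinite (laplace μ b) := by
  unfold laplace; infer_instance

/-- The `⌊ξ⌋`-th smallest entry of `y` when `1 ≤ ξ ≤ k`; `-∞` when `ξ < 1`; `∞` when `ξ > k`. -/
def ordSt {k : ℕ} (y : Fin k → ℝ) (ξ : ℝ) : EReal :=
  if h : 1 ≤ ξ ∧ ξ ≤ k then
    ((y (Tuple.sort y ⟨⌊ξ⌋₊ - 1, by
      have h1 : 1 ≤ ⌊ξ⌋₊ := Nat.le_floor (by exact_mod_cast h.1)
      have h2 : ⌊ξ⌋₊ ≤ k := Nat.floor_le_of_le h.2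
      omega⟩) : ℝ) : EReal)
  else if ξ < 1 then ⊥ else ⊤

open Classical in
/-- The first index `t` for which the noisy order statistic `ordSt (y t) (ξ₀ + ξ t)` is at least
`τ`; the value `⊤` means that there is none. -/
def aboveThr {T k : ℕ} (y : Fin T → Fin k → ℝ) (τ ξ₀ : ℝ) (ξ : Fin T → ℝ) : WithTop (Fin T) :=
  (Finset.univ.filter fun t : Fin T => (τ : EReal) ≤ ordSt (y t) (ξ₀ + ξ t)).min

/-! ### The private quantile procedure and its confidence set -/

/-- The sets `I_t = {u | ‖u‖₂ ≤ t / √n}`; the index `t ∈ {1, …, n}` is `t.val + 1`. -/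
def ballSet (d : ℕ) {n : ℕ} (t : Fin n) : Set (EuclideanSpace ℝ (Fin d)) :=
  {u | ‖u‖ ≤ ((t : ℝ) + 1) / √(n : ℝ)}

/-- Coverage estimate for the set `I` from the subsample `y`: the proportion, among the `N` Monte
Carlo draws `r j` of a resample and an estimator noise, of those for which the private bootstrap
statistic is in `I`. `N = ⊤` stands for the absence of Monte Carlo error: the estimate is then
the exact conditional probability given `y`. -/
def coverageEst {𝒳 𝒲 : Type*} [MeasurableSpace 𝒳] [MeasurableSpace 𝒲] {d : ℕ}
    (ν : Measure 𝒲) (θ : Measure 𝒳 → EuclideanSpace ℝ (Fin d)) {m n : ℕ}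
    (θt : (Fin n → 𝒳) → 𝒲 → EuclideanSpace ℝ (Fin d)) (N : ℕ∞) (y : Fin m → 𝒳)
    (r : Fin N.toNat → (Fin n → Fin m) × 𝒲) (I : Set (EuclideanSpace ℝ (Fin d))) : ℝ :=
  if N = ⊤ then
    ((resampleLaw m n).prod ν).real {q | privBlbStat θ θt y q ∈ I}
  else
    (N.toNat : ℝ)⁻¹ * ∑ j, I.indicator (fun _ => (1 : ℝ)) (privBlbStat θ θt y (r j))

/-- Everything random in one run at sample size `n`, with subsample size `m` and `N` Monte Carlo
draws for each subsample and each of the `n` sets. -/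
structure Outcome (𝒳 𝒲 : Type*) (n m : ℕ) (N : ℕ∞) where
  data : ℕ → 𝒳
  splitting : Splitting n m
  draws : Fin (n / m) × Fin n × Fin N.toNat → (Fin n → Fin m) × 𝒲
  noise : 𝒲
  xi0 : ℝ
  xi : Fin n → ℝ

/-- Reads an outcome off a tuple. -/
def Outcome.ofTuple {𝒳 𝒲 : Type*} {n m : ℕ} {N : ℕ∞}
    (p : (ℕ → 𝒳) × Splitting n m ×
      (Fin (n / m) × Fin n × Fin N.toNat → (Fin n → Fin m) × 𝒲) × 𝒲 × ℝ × (Fin n → ℝ)) :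
    Outcome 𝒳 𝒲 n m N :=
  ⟨p.1, p.2.1, p.2.2.1, p.2.2.2.1, p.2.2.2.2.1, p.2.2.2.2.2⟩

/-- The joint law of one run, all components being independent: the data are i.i.d. `P`, the
splitting has law `κ`, the Monte Carlo draws are i.i.d., the noise of the released estimator has
law `ν`, `ξ₀ ∼ Lap(s/2, 2/ε)` with `s = ⌊n/m⌋`, and `ξ₁, …, ξₙ` are i.i.d. `Lap(0, 4/ε)`. -/
def runLaw {𝒳 𝒲 : Type*} [MeasurableSpace 𝒳] [MeasurableSpace 𝒲]
    (P : Measure 𝒳) [IsProbabilityMeasure P] (ν : Measure 𝒲) [IsProbabilityMeasure ν]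
    (n m : ℕ) (κ : PMF (Splitting n m)) (N : ℕ∞) (ε : ℝ) :
    Measure ((ℕ → 𝒳) × Splitting n m ×
      (Fin (n / m) × Fin n × Fin N.toNat → (Fin n → Fin m) × 𝒲) × 𝒲 × ℝ × (Fin n → ℝ)) :=
  (dataLaw P).prod <| κ.toMeasure.prod <|
    (Measure.pi fun _ : Fin (n / m) × Fin n × Fin N.toNat => (resampleLaw m n).prod ν).prod <|
      ν.prod <| (laplace (((n / m : ℕ) : ℝ) / 2) (2 / ε)).prod <|
        Measure.pi fun _ : Fin n => laplace 0 (4 / ε)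

/-- The index returned by the private quantile procedure at level `1 - α`, run with the sets
`ballSet d t`; `⊤` means that no index is returned. -/
def blbQuant {𝒳 𝒲 : Type*} [MeasurableSpace 𝒳] [MeasurableSpace 𝒲] {d : ℕ}
    (ν : Measure 𝒲) (θ : Measure 𝒳 → EuclideanSpace ℝ (Fin d)) {n m : ℕ}
    (θt : (Fin n → 𝒳) → 𝒲 → EuclideanSpace ℝ (Fin d)) (N : ℕ∞) (α : ℝ)
    (o : Outcome 𝒳 𝒲 n m N) : WithTop (Fin n) :=
  aboveThr
    (fun t i => coverageEst ν θ θt N (subsample o.splitting o.data i)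
      (fun j => o.draws (i, t, j)) (ballSet d t))
    (1 - α) o.xi0 o.xi

/-- The confidence set `C_α(Pₙ) = θ̃(Pₙ, Wₙ) + n^{-1/2} I_t̂`, where `t̂` is the returned index. If
no index is returned, the set `Inone` is used in place of `I_t̂`. -/
def confSet {𝒳 𝒲 : Type*} [MeasurableSpace 𝒳] [MeasurableSpace 𝒲] {d : ℕ}
    (ν : Measure 𝒲) (θ : Measure 𝒳 → EuclideanSpace ℝ (Fin d)) {n m : ℕ}
    (θt : (Fin n → 𝒳) → 𝒲 → EuclideanSpace ℝ (Fin d)) (N : ℕ∞) (α : ℝ)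
    (Inone : Set (EuclideanSpace ℝ (Fin d))) (o : Outcome 𝒳 𝒲 n m N) :
    Set (EuclideanSpace ℝ (Fin d)) :=
  (fun u => θt (sample n o.data) o.noise + (√(n : ℝ))⁻¹ • u) ''
    (match blbQuant ν θ θt N α o with
      | ⊤ => Inone
      | (t : Fin n) => ballSet d t)

end PrivBLB

end

namespace PrivBLB

/-! ### Weak convergence from distribution functions -/

/-- The lower orthant with vertex `u`. -/
def orthant {d : ℕ} (u : Fin d → ℝ) : Set (EuclideanSpace ℝ (Fin d)) := {v | ∀ j, v j ≤ u j}

/-- The vectors whose coordinates are not atoms of a coordinate projection of `μ`. -/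
def AtomFree {d : ℕ} (μ : Measure (EuclideanSpace ℝ (Fin d))) (u : Fin d → ℝ) : Prop :=
  ∀ i j, μ {v | v i = u j} = 0

lemma measurableSet_orthant {d : ℕ} (u : Fin d → ℝ) : MeasurableSet (orthant u) := by
  have : orthant u = ⋂ j, {v : EuclideanSpace ℝ (Fin d) | v j ≤ u j} := by
    ext; simp [orthant]
  rw [this]
  exact MeasurableSet.iInter fun j => measurableSet_le (by fun_prop) measurable_const

lemma orthant_inter {d : ℕ} (u w : Fin d → ℝ) :
    orthant u ∩ orthant w = orthant fun j => min (u j) (w j) := by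
  ext v
  simp only [orthant, Set.mem_inter_iff, Set.mem_ofPred_eq, le_min_iff]
  exact forall_and.symm

lemma isPiSystem_orthant {d : ℕ} (μ : Measure (EuclideanSpace ℝ (Fin d))) :
    IsPiSystem (orthant '' {u | AtomFree μ u}) := by
  rintro _ ⟨u, hu, rfl⟩ _ ⟨w, hw, rfl⟩ -
  refine ⟨_, fun i j => ?_, (orthant_inter u w).symm⟩
  rcases min_choice (u j) (w j) with h | h <;> simp only [h]
  exacts [hu i j, hw i j]

/-- The half-open box with corners `a` and `b`. -/
def box {d : ℕ} (a b : Fin d → ℝ) : Set (EuclideanSpace ℝ (Fin d)) :=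
  {v | ∀ j, a j < v j ∧ v j ≤ b j}

lemma box_inter {d : ℕ} (a b a' b' : Fin d → ℝ) :
    box a b ∩ box a' b' = box (fun j => max (a j) (a' j)) fun j => min (b j) (b' j) := by
  ext v
  simp only [box, Set.mem_inter_iff, Set.mem_ofPred_eq, le_min_iff, max_lt_iff]
  constructor
  · rintro ⟨h, h'⟩ j
    exact ⟨⟨(h j).1, (h' j).1⟩, (h j).2, (h' j).2⟩
  · intro h
    exact ⟨fun j => ⟨(h j).1.1, (h j).2.1⟩, fun j => ⟨(h j).1.2, (h j).2.2⟩⟩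

lemma box_eq_diff {d : ℕ} (a b : Fin d → ℝ) :
    box a b = orthant b \ ⋃ j, orthant (Function.update b j (min (a j) (b j))) := by
  ext v
  simp only [box, orthant, Set.mem_ofPred_eq, Set.mem_sdiff, Set.mem_iUnion, not_exists]
  constructor
  · intro h
    refine ⟨fun j => (h j).2, fun j hj => ?_⟩
    have := hj j
    rw [Function.update_self] at this
    exact absurd (h j).1 (not_lt.2 (this.trans (min_le_left _ _)))
  · rintro ⟨h, h'⟩ j
    refine ⟨lt_of_not_ge fun hj => h' j fun k => ?_, h j⟩
    rcases eq_or_ne k j with rfl | hk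
    · rw [Function.update_self]; exact le_min hj (h _)
    · rw [Function.update_of_ne hk]; exact h k

lemma atomFree_update {d : ℕ} {μ : Measure (EuclideanSpace ℝ (Fin d))} {a b : Fin d → ℝ}
    (ha : AtomFree μ a) (hb : AtomFree μ b) (j : Fin d) :
    AtomFree μ (Function.update b j (min (a j) (b j))) := by
  intro i k
  rcases eq_or_ne k j with rfl | hk
  · rw [Function.update_self]
    rcases min_choice (a k) (b k) with h | h <;> rw [h]
    exacts [ha i k, hb i k]
  · rw [Function.update_of_ne hk]; exact hb i k

lemma tendsto_box {ι : Type*} {l : Filter ι} {d : ℕ}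
    {ρ : ι → ProbabilityMeasure (EuclideanSpace ℝ (Fin d))}
    {μ : ProbabilityMeasure (EuclideanSpace ℝ (Fin d))}
    (h : ∀ u, AtomFree μ.toMeasure u →
      Tendsto (fun i => (ρ i).toMeasure.real (orthant u)) l
        (𝓝 (μ.toMeasure.real (orthant u))))
    {a b : Fin d → ℝ} (ha : AtomFree μ.toMeasure a) (hb : AtomFree μ.toMeasure b) :
    Tendsto (fun i => (ρ i).toMeasure.real (box a b)) l (𝓝 (μ.toMeasure.real (box a b))) := by
  classical
  set c : Fin d → Fin d → ℝ := fun j => Function.update b j (min (a j) (b j)) with hc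
  have hsub : (⋃ j, orthant (c j)) ⊆ orthant b := by
    refine Set.iUnion_subset fun j v hv k => (hv k).trans ?_
    rcases eq_or_ne k j with rfl | hk
    · simp [hc]
    · simp [hc, Function.update_of_ne hk]
  have hm : MeasurableSet (⋃ j, orthant (c j)) :=
    MeasurableSet.iUnion fun j => measurableSet_orthant _
  have key (ζ : ProbabilityMeasure (EuclideanSpace ℝ (Fin d))) :
      ζ.toMeasure.real (box a b)
        = ζ.toMeasure.real (orthant b) - ζ.toMeasure.real (⋃ j, orthant (c j)) := by
    rw [box_eq_diff, measureReal_sdiff hsub hm]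
  simp_rw [key]
  refine (h b hb).sub ?_
  have := (isPiSystem_orthant μ.toMeasure).tendsto_measureReal_biUnion
    (l := l) (μ := fun i => (ρ i).toMeasure) (ν := μ.toMeasure)
    (t := Finset.univ.image fun j => orthant (c j))
    (by
      intro s hs
      obtain ⟨j, -, rfl⟩ := Finset.mem_image.1 hs
      exact ⟨c j, atomFree_update ha hb j, rfl⟩)
    (by rintro _ ⟨u, -, rfl⟩; exact measurableSet_orthant u)
    (by rintro _ ⟨u, hu, rfl⟩; exact h u hu)
  simpa using this

lemma dense_atomFree {d : ℕ} (μ : Measure (EuclideanSpace ℝ (Fin d))) [IsFiniteMeasure μ] :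
    Dense {c : ℝ | ∀ i, μ {v | v i = c} = 0} := by
  have hc : (⋃ i : Fin d, {c : ℝ | 0 < μ {v | v i = c}}).Countable :=
    Set.countable_iUnion fun i =>
      Measure.countable_meas_level_set_pos (μ := μ)
        (g := fun v : EuclideanSpace ℝ (Fin d) => v i) (by fun_prop)
  convert hc.dense_compl ℝ using 1
  ext c
  simp

lemma exists_box_subset {d : ℕ} (μ : Measure (EuclideanSpace ℝ (Fin d))) [IsFiniteMeasure μ]
    {U : Set (EuclideanSpace ℝ (Fin d))} (hU : IsOpen U) {x : EuclideanSpace ℝ (Fin d)}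
    (hx : x ∈ U) : ∃ a b, AtomFree μ a ∧ AtomFree μ b ∧ box a b ∈ 𝓝 x ∧ box a b ⊆ U := by
  have hcont : Continuous (WithLp.toLp 2 : (Fin d → ℝ) → EuclideanSpace ℝ (Fin d)) :=
    PiLp.continuous_toLp 2 _
  have hV : IsOpen ((WithLp.toLp 2 : (Fin d → ℝ) → EuclideanSpace ℝ (Fin d)) ⁻¹' U) :=
    hU.preimage hcont
  obtain ⟨r, hr, hball⟩ := Metric.isOpen_iff.1 hV (WithLp.ofLp x) (by simpa using hx)
  have h1 (j : Fin d) : ∃ c ∈ {c : ℝ | ∀ i, μ {v | v i = c} = 0}, c ∈ Set.Ioo (x j - r) (x j) :=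
    let ⟨c, h, h'⟩ := (dense_atomFree μ).exists_between (sub_lt_self (x j) hr); ⟨c, h, h'⟩
  have h2 (j : Fin d) : ∃ c ∈ {c : ℝ | ∀ i, μ {v | v i = c} = 0}, c ∈ Set.Ioo (x j) (x j + r) :=
    let ⟨c, h, h'⟩ := (dense_atomFree μ).exists_between (lt_add_of_pos_right (x j) hr); ⟨c, h, h'⟩
  choose a ha ha' using h1
  choose b hb hb' using h2
  refine ⟨a, b, fun i j => ha j i, fun i j => hb j i, ?_, fun v hv => ?_⟩
  · have hopen : IsOpen (⋂ j, {v : EuclideanSpace ℝ (Fin d) | a j < v j ∧ v j < b j}) :=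
      isOpen_iInter_of_finite fun j =>
        (isOpen_lt (f := fun _ => a j) (g := fun v : EuclideanSpace ℝ (Fin d) => v j)
          (by fun_prop) (by fun_prop)).inter
        (isOpen_lt (f := fun v : EuclideanSpace ℝ (Fin d) => v j) (g := fun _ => b j)
          (by fun_prop) (by fun_prop))
    refine mem_of_superset (hopen.mem_nhds ?_) ?_
    · simp only [Set.mem_iInter]; exact fun j => ⟨(ha' j).2, (hb' j).1⟩
    · intro v hv j
      simp only [Set.mem_iInter] at hv
      exact ⟨(hv j).1, (hv j).2.le⟩
  · have : WithLp.ofLp v ∈ Metric.ball (WithLp.ofLp x) r := by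
      rw [Metric.mem_ball, dist_pi_lt_iff hr]
      intro j
      rw [Real.dist_eq, abs_lt]
      have := hv j
      have h3 := ha' j
      have h4 := hb' j
      simp only [Set.mem_Ioo] at h3 h4
      constructor <;> linarith [this.1, this.2]
    simpa using hball this

/-- Convergence of the distribution functions at all atom-free points implies weak convergence. -/
theorem tendsto_of_tendsto_orthant {ι : Type*} {l : Filter ι} [l.IsCountablyGenerated] {d : ℕ}
    {ρ : ι → ProbabilityMeasure (EuclideanSpace ℝ (Fin d))}
    {μ : ProbabilityMeasure (EuclideanSpace ℝ (Fin d))}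
    (h : ∀ u, AtomFree μ.toMeasure u →
      Tendsto (fun i => (ρ i).toMeasure.real (orthant u)) l
        (𝓝 (μ.toMeasure.real (orthant u)))) :
    Tendsto ρ l (𝓝 μ) := by
  have hS : IsPiSystem {s | ∃ a b, AtomFree μ.toMeasure a ∧
      AtomFree μ.toMeasure b ∧ s = box a b} := by
    rintro _ ⟨a, b, ha, hb, rfl⟩ _ ⟨a', b', ha', hb', rfl⟩ -
    refine ⟨_, _, fun i j => ?_, fun i j => ?_, box_inter a b a' b'⟩
    · rcases max_choice (a j) (a' j) with h | h <;> simp only [h]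
      exacts [ha i j, ha' i j]
    · rcases min_choice (b j) (b' j) with h | h <;> simp only [h]
      exacts [hb i j, hb' i j]
  refine hS.tendsto_probabilityMeasure_of_tendsto_of_mem ?_ ?_ ?_
  · rintro _ ⟨a, b, -, -, rfl⟩
    rw [box_eq_diff]
    exact (measurableSet_orthant _).diff (MeasurableSet.iUnion fun j => measurableSet_orthant _)
  · intro U hU x hx
    obtain ⟨a, b, ha, hb, h1, h2⟩ :=
      exists_box_subset μ.toMeasure hU hx
    exact ⟨_, ⟨a, b, ha, hb, rfl⟩, h1, h2⟩
  · rintro _ ⟨a, b, ha, hb, rfl⟩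
    have := tendsto_box h ha hb
    rw [← NNReal.tendsto_coe]
    exact this

lemma frontier_orthant_null {d : ℕ} {μ : Measure (EuclideanSpace ℝ (Fin d))} {u : Fin d → ℝ}
    (hu : AtomFree μ u) : μ (frontier (orthant u)) = 0 := by
  have hsub : frontier (orthant u) ⊆ ⋃ j, {v | v j = u j} := by
    have hcl : IsClosed (orthant u) := by
      have : orthant u = ⋂ j, {v : EuclideanSpace ℝ (Fin d) | v j ≤ u j} := by
        ext; simp [orthant]
      rw [this]
      exact isClosed_iInter fun j => isClosed_le (by fun_prop) continuous_const
    have hopen : IsOpen (⋂ j, {v : EuclideanSpace ℝ (Fin d) | v j < u j}) :=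
      isOpen_iInter_of_finite fun j => isOpen_lt (by fun_prop) continuous_const
    have hint : (⋂ j, {v : EuclideanSpace ℝ (Fin d) | v j < u j}) ⊆ interior (orthant u) :=
      interior_maximal (fun v hv j => (Set.mem_iInter.1 hv j).le) hopen
    intro v hv
    rw [frontier, hcl.closure_eq] at hv
    by_contra hne
    simp only [Set.mem_iUnion, Set.mem_ofPred_eq, not_exists] at hne
    exact hv.2 (hint (Set.mem_iInter.2 fun j => lt_of_le_of_ne (hv.1 j) (hne j)))
  exact measure_mono_null hsub (measure_iUnion_null fun j => hu j j)

lemma tendsto_orthant {ι : Type*} {l : Filter ι} {d : ℕ}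
    {ρ : ι → ProbabilityMeasure (EuclideanSpace ℝ (Fin d))}
    {μ : ProbabilityMeasure (EuclideanSpace ℝ (Fin d))} (h : Tendsto ρ l (𝓝 μ))
    {u : Fin d → ℝ} (hu : AtomFree μ.toMeasure u) :
    Tendsto (fun i => (ρ i).toMeasure.real (orthant u)) l
      (𝓝 (μ.toMeasure.real (orthant u))) := by
  have := ProbabilityMeasure.tendsto_measure_of_null_frontier_of_tendsto' h
    (frontier_orthant_null hu)
  exact (ENNReal.tendsto_toReal (measure_ne_top _ _)).comp this

lemma tendsto_closedBall {ι : Type*} {l : Filter ι} {d : ℕ}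
    {ρ : ι → ProbabilityMeasure (EuclideanSpace ℝ (Fin d))}
    {μ : ProbabilityMeasure (EuclideanSpace ℝ (Fin d))} (h : Tendsto ρ l (𝓝 μ)) {r : ℝ}
    (hr : μ.toMeasure {v | ‖v‖ = r} = 0) :
    Tendsto (fun i => (ρ i).toMeasure.real {v | ‖v‖ ≤ r}) l
      (𝓝 (μ.toMeasure.real {v | ‖v‖ ≤ r})) := by
  have := ProbabilityMeasure.tendsto_measure_of_null_frontier_of_tendsto' h (E := {v | ‖v‖ ≤ r})
    (measure_mono_null (frontier_le_subset_eq continuous_norm continuous_const) hr)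
  exact (ENNReal.tendsto_toReal (measure_ne_top _ _)).comp this

lemma abs_sub_le_ksDist {d : ℕ} (μ ρ : Measure (EuclideanSpace ℝ (Fin d)))
    [IsProbabilityMeasure μ] [IsProbabilityMeasure ρ] (u : Fin d → ℝ) :
    |μ.real (orthant u) - ρ.real (orthant u)| ≤ ksDist μ ρ := by
  have hb : BddAbove (Set.range fun u : EuclideanSpace ℝ (Fin d) =>
      |μ.real {v | ∀ j, v j ≤ u j} - ρ.real {v | ∀ j, v j ≤ u j}|) := by
    refine ⟨1, ?_⟩
    rintro _ ⟨w, rfl⟩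
    have h1 : μ.real {v | ∀ j, v j ≤ w j} ≤ 1 := measureReal_le_one
    have h2 : ρ.real {v | ∀ j, v j ≤ w j} ≤ 1 := measureReal_le_one
    have h3 : 0 ≤ μ.real {v | ∀ j, v j ≤ w j} := measureReal_nonneg
    have h4 : 0 ≤ ρ.real {v | ∀ j, v j ≤ w j} := measureReal_nonneg
    exact abs_le.2 ⟨by linarith, by linarith⟩
  exact le_ciSup hb (WithLp.toLp 2 u)

/-- A measure which is close in Kolmogorov–Smirnov distance to a late term of a weakly convergent
sequence gives a centered ball nearly the mass that the limit gives it. -/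
theorem exists_ksDist_closedBall {d : ℕ}
    {F : ℕ → ProbabilityMeasure (EuclideanSpace ℝ (Fin d))}
    {μ : ProbabilityMeasure (EuclideanSpace ℝ (Fin d))} (hF : Tendsto F atTop (𝓝 μ)) {r : ℝ}
    (hr : μ.toMeasure {v | ‖v‖ = r} = 0) {γ : ℝ} (hγ : 0 < γ) :
    ∃ δ > 0, ∀ᶠ n in atTop, ∀ ρ : Measure (EuclideanSpace ℝ (Fin d)), IsProbabilityMeasure ρ →
      ksDist (F n).toMeasure ρ < δ →
        |ρ.real {v | ‖v‖ ≤ r} - μ.toMeasure.real {v | ‖v‖ ≤ r}| < γ := by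
  by_contra! hcon
  have key (k : ℕ) : ∃ n, k ≤ n ∧ ∃ ρ : ProbabilityMeasure (EuclideanSpace ℝ (Fin d)),
      ksDist (F n).toMeasure ρ.toMeasure < 1 / ((k : ℝ) + 1) ∧
        γ ≤ |ρ.toMeasure.real {v | ‖v‖ ≤ r} - μ.toMeasure.real {v | ‖v‖ ≤ r}| := by
    obtain ⟨n, hn, ρ, hρ, h1, h2⟩ := frequently_atTop.1 (hcon (1 / ((k : ℝ) + 1)) (by positivity)) k
    exact ⟨n, hn, ⟨ρ, hρ⟩, h1, h2⟩
  choose n hn ρ h1 h2 using key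
  have hnt : Tendsto n atTop atTop := tendsto_atTop_mono hn tendsto_id
  have hlim : Tendsto ρ atTop (𝓝 μ) := by
    refine tendsto_of_tendsto_orthant fun u hu => ?_
    have hFn := (tendsto_orthant hF hu).comp hnt
    have hdiff : Tendsto (fun k => ((F (n k)).toMeasure.real (orthant u)
        - (ρ k).toMeasure.real (orthant u))) atTop (𝓝 0) := by
      refine squeeze_zero_norm (fun k => ?_) tendsto_one_div_add_atTop_nhds_zero_nat
      exact (abs_sub_le_ksDist _ _ u).trans (h1 k).le
    simpa using hFn.sub hdiff
  have hb := (tendsto_closedBall hlim hr).sub_const (μ.toMeasure.real {v | ‖v‖ ≤ r})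
  have hb' := hb.abs
  simp only [sub_self, abs_zero] at hb'
  exact absurd (ge_of_tendsto' hb' h2) (not_le.2 hγ)

/-! ### The norm of a Gaussian vector -/

lemma pi_absolutelyContinuous {d : ℕ} {μ ρ : Measure ℝ} [SigmaFinite μ] [SigmaFinite ρ]
    (h : μ ≪ ρ) : (Measure.pi fun _ : Fin d => μ) ≪ Measure.pi fun _ : Fin d => ρ := by
  induction d with
  | zero => simp only [Measure.pi_of_empty (x := isEmptyElim)]; rfl
  | succ d ih =>
    have h1 := (measurePreserving_piFinSuccAbove (fun _ : Fin (d + 1) => μ) 0).symm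
    have h2 := (measurePreserving_piFinSuccAbove (fun _ : Fin (d + 1) => ρ) 0).symm
    rw [← h1.map_eq, ← h2.map_eq]
    exact (h.prod ih).map (MeasurableEquiv.measurable _)

lemma stdGaussian_absolutelyContinuous (d : ℕ) :
    stdGaussian (EuclideanSpace ℝ (Fin d)) ≪ volume := by
  rw [← map_pi_eq_stdGaussian, ← (PiLp.volume_preserving_toLp (Fin d)).map_eq, volume_pi]
  exact (pi_absolutelyContinuous (gaussianReal_absolutelyContinuous 0 one_ne_zero)).map
    (by fun_prop)

lemma stdGaussian_isOpen_pos {d : ℕ} {U : Set (EuclideanSpace ℝ (Fin d))} (hU : IsOpen U)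
    (hne : U.Nonempty) : 0 < stdGaussian (EuclideanSpace ℝ (Fin d)) U := by
  have : (gaussianReal 0 1).IsOpenPosMeasure :=
    (gaussianReal_absolutelyContinuous' 0 one_ne_zero).isOpenPosMeasure
  have hcont : Continuous (WithLp.toLp 2 : (Fin d → ℝ) → EuclideanSpace ℝ (Fin d)) :=
    PiLp.continuous_toLp 2 _
  rw [← map_pi_eq_stdGaussian, Measure.map_apply hcont.measurable hU.measurableSet]
  refine (hU.preimage hcont).measure_pos _ ?_
  obtain ⟨v, hv⟩ := hne
  exact ⟨WithLp.ofLp v, by simpa using hv⟩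

/-- The image of the standard Gaussian measure under a nonzero linear map gives spheres mass zero. -/
lemma stdGaussian_norm_eq_null {d : ℕ}
    {A : EuclideanSpace ℝ (Fin d) →L[ℝ] EuclideanSpace ℝ (Fin d)} (hA : A ≠ 0) (r : ℝ) :
    stdGaussian (EuclideanSpace ℝ (Fin d)) {x | ‖A x‖ = r} = 0 := by
  refine stdGaussian_absolutelyContinuous d ?_
  have hconv : Convex ℝ {x | ‖A x‖ ≤ r} := by
    have := (convexOn_norm (convex_univ (𝕜 := ℝ) (E := EuclideanSpace ℝ (Fin d)))).comp_linearMap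
      A.toLinearMap
    simpa using this.convex_le r
  refine measure_mono_null ?_ (hconv.addHaar_frontier volume)
  intro x hx
  have hx' : ‖A x‖ = r := hx
  rw [frontier, Set.mem_sdiff]
  refine ⟨subset_closure hx'.le, fun hint => ?_⟩
  obtain ⟨v, hv⟩ : ∃ v, r < ‖A (x + v)‖ ∧ ∀ t : ℝ, 0 < t → r < ‖A (x + t • v)‖ := by
    by_cases h0 : A x = 0
    · obtain ⟨w, hw⟩ : ∃ w, A w ≠ 0 := by
        by_contra! hcon
        exact hA (ContinuousLinearMap.ext hcon)
      have hr : r = 0 := by rw [← hx', h0, norm_zero]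
      have key (t : ℝ) (ht : 0 < t) : r < ‖A (x + t • w)‖ := by
        rw [map_add, map_smul, h0, zero_add, hr]
        exact norm_pos_iff.2 (smul_ne_zero ht.ne' hw)
      exact ⟨w, by simpa using key 1 one_pos, key⟩
    · have hr : 0 < r := by rw [← hx']; exact norm_pos_iff.2 h0
      have key (t : ℝ) (ht : 0 < t) : r < ‖A (x + t • x)‖ := by
        have : x + t • x = (1 + t) • x := by rw [add_smul, one_smul]
        rw [this, map_smul, norm_smul, hx', Real.norm_of_nonneg (by linarith)]
        nlinarith
      exact ⟨x, by simpa using key 1 one_pos, key⟩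
  have hlim : Tendsto (fun t : ℝ => x + t • v) (𝓝[>] 0) (𝓝 x) := by
    have : Continuous fun t : ℝ => x + t • v := by fun_prop
    have h := this.tendsto 0
    simp only [zero_smul, add_zero] at h
    exact h.mono_left nhdsWithin_le_nhds
  have hev := (hlim.eventually (mem_interior_iff_mem_nhds.1 hint)).and self_mem_nhdsWithin
  obtain ⟨t, ht1, ht2⟩ := hev.exists
  exact absurd (hv.2 t ht2) (not_lt.2 ht1)

section

variable {d : ℕ} {Sig : Matrix (Fin d) (Fin d) ℝ}

open scoped MatrixOrder in
lemma toEuclideanCLM_sqrt_ne_zero (hSig : Sig.PosSemidef) (hSig0 : Sig ≠ 0) :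
    Matrix.toEuclideanCLM (𝕜 := ℝ) (CFC.sqrt Sig) ≠ 0 := by
  intro h
  have h1 : CFC.sqrt Sig = 0 :=
    EquivLike.injective (Matrix.toEuclideanCLM (n := Fin d) (𝕜 := ℝ)) (by rw [h, map_zero])
  have h2 := CFC.sqrt_mul_sqrt_self Sig hSig.nonneg
  rw [h1, mul_zero] at h2
  exact hSig0 h2.symm

lemma multivariateGaussian_zero_apply {s : Set (EuclideanSpace ℝ (Fin d))}
    (hs : MeasurableSet s) :
    multivariateGaussian 0 Sig s = stdGaussian (EuclideanSpace ℝ (Fin d))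
      ((Matrix.toEuclideanCLM (𝕜 := ℝ) (open scoped MatrixOrder in CFC.sqrt Sig)) ⁻¹' s) := by
  rw [multivariateGaussian, Measure.map_apply (by fun_prop) hs]
  simp

lemma multivariateGaussian_norm_eq_null (hSig : Sig.PosSemidef) (hSig0 : Sig ≠ 0) (r : ℝ) :
    multivariateGaussian 0 Sig {v | ‖v‖ = r} = 0 := by
  rw [multivariateGaussian_zero_apply (measurableSet_eq_fun (by fun_prop) (by fun_prop))]
  exact stdGaussian_norm_eq_null (toEuclideanCLM_sqrt_ne_zero hSig hSig0) r

lemma multivariateGaussian_annulus_pos (hSig : Sig.PosSemidef) (hSig0 : Sig ≠ 0) {a b : ℝ}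
    (ha : 0 ≤ a) (hab : a < b) : 0 < multivariateGaussian 0 Sig {v | a < ‖v‖ ∧ ‖v‖ < b} := by
  have hopen : IsOpen {v : EuclideanSpace ℝ (Fin d) | a < ‖v‖ ∧ ‖v‖ < b} :=
    (isOpen_lt continuous_const continuous_norm).inter (isOpen_lt continuous_norm continuous_const)
  rw [multivariateGaussian_zero_apply hopen.measurableSet]
  refine stdGaussian_isOpen_pos (hopen.preimage (ContinuousLinearMap.continuous _)) ?_
  obtain ⟨w, hw⟩ : ∃ w, Matrix.toEuclideanCLM (𝕜 := ℝ)
      (open scoped MatrixOrder in CFC.sqrt Sig) w ≠ 0 := by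
    by_contra! hcon
    exact toEuclideanCLM_sqrt_ne_zero hSig hSig0 (ContinuousLinearMap.ext hcon)
  set y := Matrix.toEuclideanCLM (𝕜 := ℝ) (open scoped MatrixOrder in CFC.sqrt Sig) w
  have hy : 0 < ‖y‖ := norm_pos_iff.2 hw
  refine ⟨(((a + b) / 2) / ‖y‖) • w, ?_⟩
  have hn : ‖(((a + b) / 2) / ‖y‖) • y‖ = (a + b) / 2 := by
    rw [norm_smul, Real.norm_of_nonneg (div_nonneg (by linarith) hy.le), div_mul_cancel₀ _ hy.ne']
  rw [Set.mem_preimage, map_smul]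
  change a < ‖(((a + b) / 2) / ‖y‖) • y‖ ∧ ‖(((a + b) / 2) / ‖y‖) • y‖ < b
  rw [hn]
  constructor <;> linarith

/-- The distribution function of the norm of a vector with law `μ`. -/
noncomputable def normCDF (μ : Measure (EuclideanSpace ℝ (Fin d))) (r : ℝ) : ℝ :=
  μ.real {v | ‖v‖ ≤ r}

lemma normCDF_eq_cdf (μ : Measure (EuclideanSpace ℝ (Fin d))) [IsProbabilityMeasure μ] (r : ℝ) :
    normCDF μ r = cdf (μ.map norm) r := by
  have : IsProbabilityMeasure (μ.map norm) :=
    Measure.isProbabilityMeasure_map measurable_norm.aemeasurable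
  rw [cdf_eq_real, map_measureReal_apply measurable_norm measurableSet_Iic]
  rfl

lemma continuous_normCDF {μ : Measure (EuclideanSpace ℝ (Fin d))} [IsProbabilityMeasure μ]
    (h : ∀ r, μ {v | ‖v‖ = r} = 0) : Continuous (normCDF μ) := by
  have : IsProbabilityMeasure (μ.map norm) :=
    Measure.isProbabilityMeasure_map measurable_norm.aemeasurable
  have heq : normCDF μ = cdf (μ.map norm) := funext (normCDF_eq_cdf μ)
  rw [heq, continuous_iff_continuousAt]
  intro r
  rw [(monotone_cdf _).continuousAt_iff_leftLim_eq_rightLim, StieltjesFunction.rightLim_eq]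
  have h1 : (cdf (μ.map norm)).measure {r} = 0 := by
    rw [measure_cdf, Measure.map_apply measurable_norm (measurableSet_singleton r)]
    exact h r
  rw [StieltjesFunction.measure_singleton, ENNReal.ofReal_eq_zero] at h1
  exact le_antisymm ((monotone_cdf _).leftLim_le le_rfl) (by linarith)

lemma exists_normCDF_eq {μ : Measure (EuclideanSpace ℝ (Fin d))} [IsProbabilityMeasure μ]
    (h : ∀ r, μ {v | ‖v‖ = r} = 0) {τ : ℝ} (h0 : 0 < τ) (h1 : τ < 1) :
    ∃ q, 0 < q ∧ normCDF μ q = τ := by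
  have hb : Tendsto (normCDF μ) atTop (𝓝 1) := by
    have heq : normCDF μ = cdf (μ.map norm) := funext (normCDF_eq_cdf μ)
    rw [heq]; exact tendsto_cdf_atTop _
  have hz : normCDF μ 0 = 0 := by
    have : {v : EuclideanSpace ℝ (Fin d) | ‖v‖ ≤ 0} = {v | ‖v‖ = 0} := by
      ext v; exact ⟨fun hv => le_antisymm hv (norm_nonneg v), fun hv => le_of_eq hv⟩
    rw [normCDF, this, measureReal_def, h 0, ENNReal.toReal_zero]
  obtain ⟨b, hb1⟩ := (hb.eventually (lt_mem_nhds h1)).exists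
  obtain ⟨q, hq⟩ := mem_range_of_exists_le_of_exists_ge (continuous_normCDF h) (c := τ)
    ⟨0, by rw [hz]; exact h0.le⟩ ⟨b, hb1.le⟩
  refine ⟨q, ?_, hq⟩
  by_contra! hle
  have : normCDF μ q ≤ normCDF μ 0 := measureReal_mono fun v hv => le_trans hv hle
  rw [hq, hz] at this
  exact absurd h0 (not_lt.2 this)

lemma normCDF_lt_normCDF (hSig : Sig.PosSemidef) (hSig0 : Sig ≠ 0) {a b : ℝ}
    (ha : 0 ≤ a) (hab : a < b) :
    normCDF (multivariateGaussian 0 Sig) a < normCDF (multivariateGaussian 0 Sig) b := by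
  have hpos := multivariateGaussian_annulus_pos hSig hSig0 ha hab
  have hposr : 0 < (multivariateGaussian 0 Sig).real {v | a < ‖v‖ ∧ ‖v‖ < b} :=
    ENNReal.toReal_pos hpos.ne' (measure_ne_top _ _)
  have hm : MeasurableSet {v : EuclideanSpace ℝ (Fin d) | a < ‖v‖ ∧ ‖v‖ < b} :=
    (measurableSet_lt measurable_const measurable_norm).inter
      (measurableSet_lt measurable_norm measurable_const)
  have hd : Disjoint {v : EuclideanSpace ℝ (Fin d) | ‖v‖ ≤ a} {v | a < ‖v‖ ∧ ‖v‖ < b} :=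
    Set.disjoint_left.2 fun v hv hv' => absurd hv'.1 (not_lt.2 hv)
  have := measureReal_union (μ := multivariateGaussian 0 Sig) hd hm
  have hle : (multivariateGaussian 0 Sig).real
      ({v : EuclideanSpace ℝ (Fin d) | ‖v‖ ≤ a} ∪ {v | a < ‖v‖ ∧ ‖v‖ < b})
      ≤ normCDF (multivariateGaussian 0 Sig) b := by
    refine measureReal_mono ?_
    rintro v (hv | hv)
    exacts [le_trans hv hab.le, hv.2.le]
  rw [this] at hle
  change _ + _ ≤ _ at hle
  unfold normCDF at hle ⊢
  linarith

end

/-! ### Laplace tails -/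

lemma lintegral_laplace_Ioi {b : ℝ} (hb : 0 < b) {a : ℝ} (ha : 0 ≤ a) :
    ∫⁻ x in Set.Ioi a, ENNReal.ofReal ((2 * b)⁻¹ * Real.exp (-|x| / b))
      = ENNReal.ofReal (Real.exp (-a / b) / 2) := by
  have hneg : -b⁻¹ < 0 := by simpa using hb
  have h1 : ∀ x ∈ Set.Ioi a, ENNReal.ofReal ((2 * b)⁻¹ * Real.exp (-|x| / b))
      = ENNReal.ofReal ((2 * b)⁻¹ * Real.exp (-b⁻¹ * x)) := by
    intro x hx
    rw [abs_of_pos (lt_of_le_of_lt ha hx)]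
    congr 3; ring
  rw [setLIntegral_congr_fun measurableSet_Ioi h1, ← ofReal_integral_eq_lintegral_ofReal
    ((integrableOn_exp_mul_Ioi hneg a).const_mul _)
    (ae_of_all _ fun x => by positivity), integral_const_mul, integral_exp_mul_Ioi hneg a]
  congr 1
  have : -b⁻¹ * a = -a / b := by ring
  rw [this]
  field_simp

lemma laplace_tail (μ : ℝ) {b : ℝ} (hb : 0 < b) {a : ℝ} (ha : 0 ≤ a) :
    laplace μ b {x | a < |x - μ|} = ENNReal.ofReal (Real.exp (-a / b)) := by
  set f : ℝ → ℝ≥0∞ := fun x => ENNReal.ofReal ((2 * b)⁻¹ * Real.exp (-|x| / b)) with hf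
  have hm : MeasurableSet {x : ℝ | a < |x - μ|} :=
    measurableSet_lt measurable_const (by fun_prop)
  have hfm : Measurable f := by fun_prop
  have hshift : ∫⁻ x in {x : ℝ | a < |x - μ|}, f (x - μ) = ∫⁻ x in {x : ℝ | a < |x|}, f x := by
    have hmp := measurePreserving_sub_right (volume : Measure ℝ) μ
    have := hmp.setLIntegral_comp_preimage (s := {x : ℝ | a < |x|})
      (measurableSet_lt measurable_const (by fun_prop)) hfm
    exact this
  have hsplit : {x : ℝ | a < |x|} = Set.Iio (-a) ∪ Set.Ioi a := by
    ext x
    simp only [Set.mem_ofPred_eq, Set.mem_union, Set.mem_Iio, Set.mem_Ioi, lt_abs]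
    constructor <;> rintro (h | h)
    · exact Or.inr h
    · left; linarith
    · right; linarith
    · exact Or.inl h
  have hdisj : Disjoint (Set.Iio (-a)) (Set.Ioi a) := by
    rw [Set.disjoint_left]
    intro x hx hx'
    simp only [Set.mem_Iio, Set.mem_Ioi] at hx hx'
    linarith
  have hneg : ∫⁻ x in Set.Iio (-a), f x = ∫⁻ x in Set.Ioi a, f x := by
    have hmp := Measure.measurePreserving_neg (volume : Measure ℝ)
    have := hmp.setLIntegral_comp_preimage (s := Set.Ioi a) measurableSet_Ioi hfm
    rw [← this]
    simp [hf]
  rw [laplace, withDensity_apply _ hm]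
  change ∫⁻ x in {x : ℝ | a < |x - μ|}, f (x - μ) = _
  rw [hshift, hsplit, lintegral_union measurableSet_Ioi hdisj, hneg, hf,
    lintegral_laplace_Ioi hb ha, ← ENNReal.ofReal_add (by positivity) (by positivity), add_halves]

lemma isProbabilityMeasure_laplace (μ : ℝ) {b : ℝ} (hb : 0 < b) :
    IsProbabilityMeasure (laplace μ b) := by
  constructor
  have h0 := laplace_tail μ hb le_rfl
  have hpt : laplace μ b {μ} = 0 := by
    have : laplace μ b ≪ volume := withDensity_absolutelyContinuous _ _
    exact this (measure_singleton μ)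
  have hset : {x : ℝ | 0 < |x - μ|} = {μ}ᶜ := by
    ext x; simp [sub_eq_zero]
  rw [hset] at h0
  rw [← measure_add_measure_compl (measurableSet_singleton μ), hpt, h0]
  simp

/-! ### Noisy order statistics -/

lemma ordSt_lt {k : ℕ} {y : Fin k → ℝ} {ξ τ : ℝ}
    (h : ξ ≤ (Finset.univ.filter fun i => y i < τ).card) : ordSt y ξ < (τ : EReal) := by
  unfold ordSt
  split_ifs with h1 h2
  · rw [EReal.coe_lt_coe_iff]
    have hpos : 1 ≤ ⌊ξ⌋₊ := Nat.le_floor (by exact_mod_cast h1.1)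
    have hle : ⌊ξ⌋₊ ≤ k := Nat.floor_le_of_le h1.2
    set j : Fin k := ⟨⌊ξ⌋₊ - 1, by omega⟩ with hj
    by_contra! hcon
    have hsub : (Finset.univ.filter fun i => y i < τ) ⊆
        (Finset.Iio j).map (Tuple.sort y).toEmbedding := by
      intro i hi
      have hi' : y i < τ := (Finset.mem_filter.1 hi).2
      refine Finset.mem_map.2 ⟨(Tuple.sort y).symm i, ?_, by simp⟩
      refine Finset.mem_Iio.2 ?_
      by_contra! hji
      have := Tuple.monotone_sort y hji
      simp only [Function.comp_apply, Equiv.apply_symm_apply] at this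
      linarith
    have hcard := Finset.card_le_card hsub
    rw [Finset.card_map, Fin.card_Iio] at hcard
    have : ξ ≤ (⌊ξ⌋₊ - 1 : ℕ) := h.trans (by exact_mod_cast hcard)
    have h3 := Nat.floor_le_floor this
    rw [Nat.floor_natCast] at h3
    omega
  · exact EReal.bot_lt_coe τ
  · exfalso
    have hc : ((Finset.univ.filter fun i => y i < τ).card : ℝ) ≤ k := by
      exact_mod_cast (Finset.card_le_univ _).trans (by simp)
    exact h1 ⟨not_lt.1 h2, h.trans hc⟩

lemma le_ordSt {k : ℕ} {y : Fin k → ℝ} {ξ τ : ℝ}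
    (h : ((Finset.univ.filter fun i => y i < τ).card : ℝ) + 1 ≤ ξ) :
    (τ : EReal) ≤ ordSt y ξ := by
  unfold ordSt
  split_ifs with h1 h2
  · rw [EReal.coe_le_coe_iff]
    have hpos : 1 ≤ ⌊ξ⌋₊ := Nat.le_floor (by exact_mod_cast h1.1)
    have hle : ⌊ξ⌋₊ ≤ k := Nat.floor_le_of_le h1.2
    set j : Fin k := ⟨⌊ξ⌋₊ - 1, by omega⟩ with hj
    by_contra! hcon
    have hsub : (Finset.Iic j).map (Tuple.sort y).toEmbedding ⊆
        (Finset.univ.filter fun i => y i < τ) := by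
      intro i hi
      obtain ⟨l, hl, rfl⟩ := Finset.mem_map.1 hi
      have hl' : l ≤ j := Finset.mem_Iic.1 hl
      refine Finset.mem_filter.2 ⟨Finset.mem_univ _, lt_of_le_of_lt ?_ hcon⟩
      exact Tuple.monotone_sort y hl'
    have hcard := Finset.card_le_card hsub
    rw [Finset.card_map, Fin.card_Iic] at hcard
    have h3 : (Finset.univ.filter fun i => y i < τ).card + 1 ≤ ⌊ξ⌋₊ :=
      Nat.le_floor (by exact_mod_cast h)
    simp only [hj] at hcard
    omega
  · exfalso
    have : (0 : ℝ) ≤ (Finset.univ.filter fun i => y i < τ).card := by positivity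
    linarith
  · exact le_top

lemma exists_aboveThr {T k : ℕ} {y : Fin T → Fin k → ℝ} {τ ξ₀ : ℝ} {ξ : Fin T → ℝ} {t₁ : Fin T}
    (h : (τ : EReal) ≤ ordSt (y t₁) (ξ₀ + ξ t₁)) :
    ∃ t : Fin T, aboveThr y τ ξ₀ ξ = t ∧ t ≤ t₁ ∧ (τ : EReal) ≤ ordSt (y t) (ξ₀ + ξ t) := by
  classical
  unfold aboveThr
  have hmem : t₁ ∈ Finset.univ.filter fun t : Fin T => (τ : EReal) ≤ ordSt (y t) (ξ₀ + ξ t) :=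
    Finset.mem_filter.2 ⟨Finset.mem_univ _, h⟩
  obtain ⟨t, ht⟩ := Finset.min_of_mem hmem
  exact ⟨t, by convert ht, Finset.min_le_of_eq hmem ht,
    (Finset.mem_filter.1 (Finset.mem_of_min ht)).2⟩

/-- If most of the entries of `y t` fall below the threshold for every `t` in a set of rejected
indices, and most of those of `y t₁` lie above it, then an index is returned; it is at most `t₁`
and not rejected. -/
lemma exists_aboveThr_of_count {T k : ℕ} {y : Fin T → Fin k → ℝ} {τ ξ₀ : ℝ} {ξ : Fin T → ℝ}
    (hk : 8 ≤ k) (h₀ : |ξ₀ - (k : ℝ) / 2| ≤ (k : ℝ) / 8) (hξ : ∀ t, |ξ t| ≤ (k : ℝ) / 8)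
    {rej : Fin T → Prop}
    (hrej : ∀ t, rej t →
      8 * ((Finset.univ.filter fun i => τ ≤ y t i).card : ℝ) ≤ k)
    {t₁ : Fin T} (ht₁ : 8 * ((Finset.univ.filter fun i => y t₁ i < τ).card : ℝ) ≤ k) :
    ∃ t : Fin T, aboveThr y τ ξ₀ ξ = t ∧ t ≤ t₁ ∧ ¬ rej t := by
  have hk' : (8 : ℝ) ≤ k := by exact_mod_cast hk
  have hlo (t : Fin T) : (k : ℝ) / 4 ≤ ξ₀ + ξ t := by
    have h1 := (abs_le.1 h₀).1
    have h2 := (abs_le.1 (hξ t)).1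
    linarith
  have hhi (t : Fin T) : ξ₀ + ξ t ≤ 3 * (k : ℝ) / 4 := by
    have h1 := (abs_le.1 h₀).2
    have h2 := (abs_le.1 (hξ t)).2
    linarith
  obtain ⟨t, ht, hle, hord⟩ := exists_aboveThr (y := y) (τ := τ) (ξ₀ := ξ₀) (ξ := ξ) (t₁ := t₁)
    (le_ordSt (by linarith [hlo t₁]))
  refine ⟨t, ht, hle, fun hr => ?_⟩
  refine absurd hord (not_le.2 (ordSt_lt ?_))
  have hsum := Finset.card_filter_add_card_filter_not (s := (Finset.univ : Finset (Fin k)))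
    fun i => y t i < τ
  simp only [not_lt, Finset.card_univ, Fintype.card_fin] at hsum
  have hsum' : ((Finset.univ.filter fun i => y t i < τ).card : ℝ)
      + ((Finset.univ.filter fun i => τ ≤ y t i).card : ℝ) = k := by exact_mod_cast hsum
  linarith [hrej t hr, hhi t]

/-! ### Counting the indices at which an event occurs -/

open Classical in
/-- The number of indices `i` with `p i`. -/
noncomputable def count {k : ℕ} (p : Fin k → Prop) : ℕ := (Finset.univ.filter p).card

lemma count_mono {k : ℕ} {p q : Fin k → Prop} (h : ∀ i, p i → q i) : count p ≤ count q := by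
  classical
  exact Finset.card_le_card (Finset.monotone_filter_right _ fun i _ => h i)

lemma count_or_le {k : ℕ} (p q : Fin k → Prop) :
    count (fun i => p i ∨ q i) ≤ count p + count q := by
  classical
  refine (Finset.card_le_card fun i hi => ?_).trans (Finset.card_union_le _ _)
  simpa using hi

lemma setOf_le_count {Ω : Type*} {s : ℕ} (A : Fin s → Set Ω) (k : ℕ) :
    {ω | k ≤ count fun i => ω ∈ A i}
      = ⋃ S ∈ (Finset.univ : Finset (Fin s)).powersetCard k, {ω | ∀ i ∈ S, ω ∈ A i} := by
  classical
  ext ω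
  simp only [Set.mem_ofPred_eq, Set.mem_iUnion, exists_prop, Finset.mem_powersetCard]
  constructor
  · intro h
    obtain ⟨S, hS, hc⟩ := Finset.exists_subset_card_eq h
    exact ⟨S, ⟨Finset.subset_univ _, hc⟩, fun i hi => (Finset.mem_filter.1 (hS hi)).2⟩
  · rintro ⟨S, ⟨-, hc⟩, h⟩
    rw [← hc]
    exact Finset.card_le_card fun i hi => Finset.mem_filter.2 ⟨Finset.mem_univ _, h i hi⟩

lemma measurableSet_le_count {Ω : Type*} [MeasurableSpace Ω] {s : ℕ} {A : Fin s → Set Ω}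
    (hA : ∀ i, MeasurableSet (A i)) (k : ℕ) : MeasurableSet {ω | k ≤ count fun i => ω ∈ A i} := by
  rw [setOf_le_count]
  refine Finset.measurableSet_biUnion _ fun S _ => ?_
  have : {ω | ∀ i ∈ S, ω ∈ A i} = ⋂ i ∈ S, A i := by ext; simp
  rw [this]
  exact Finset.measurableSet_biInter _ fun i _ => hA i

/-- The Markov inequality for the number of occurring events. -/
lemma measure_le_count_le {Ω : Type*} [MeasurableSpace Ω] {μ : Measure Ω} {s : ℕ}
    {A : Fin s → Set Ω} (hA : ∀ i, MeasurableSet (A i)) {e : ℝ≥0∞} (he : ∀ i, μ (A i) ≤ e)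
    (k : ℕ) : k * μ {ω | k ≤ count fun i => ω ∈ A i} ≤ s * e := by
  classical
  have hsum (ω : Ω) : ∑ i, (A i).indicator (1 : Ω → ℝ≥0∞) ω
      = ((count fun i => ω ∈ A i : ℕ) : ℝ≥0∞) := by
    unfold count
    rw [Finset.card_filter]
    push_cast
    exact Finset.sum_congr rfl fun i _ => by simp [Set.indicator_apply]
  calc k * μ {ω | k ≤ count fun i => ω ∈ A i}
      = k * μ {ω | (k : ℝ≥0∞) ≤ ∑ i, (A i).indicator (1 : Ω → ℝ≥0∞) ω} := by
        simp only [hsum, Nat.cast_le]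
    _ ≤ ∫⁻ ω, ∑ i, (A i).indicator (1 : Ω → ℝ≥0∞) ω ∂μ :=
        mul_meas_ge_le_lintegral (Finset.measurable_sum _ fun i _ =>
          measurable_one.indicator (hA i)) _
    _ = ∑ i, μ (A i) := by
        rw [lintegral_finsetSum _ fun i _ => measurable_one.indicator (hA i)]
        exact Finset.sum_congr rfl fun i _ => lintegral_indicator_one (hA i)
    _ ≤ ∑ _i : Fin s, e := Finset.sum_le_sum fun i _ => he i
    _ = s * e := by simp

/-! ### Monte Carlo error -/

lemma pi_block_apply {R : Type*} [MeasurableSpace R] (ρ : Measure R) [IsProbabilityMeasure ρ]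
    {s T N : ℕ} {A : Fin s → Set (Fin N → R)} (hA : ∀ i, MeasurableSet (A i)) (t : Fin T)
    (S : Finset (Fin s)) :
    (Measure.pi fun _ : Fin s × Fin T × Fin N => ρ) {w | ∀ i ∈ S, (fun j => w (i, t, j)) ∈ A i}
      = ∏ i ∈ S, (Measure.pi fun _ : Fin N => ρ) (A i) := by
  have hinj : Function.Injective fun p : Fin s × Fin N => (p.1, t, p.2) := by
    rintro ⟨i, j⟩ ⟨i', j'⟩ h
    simp only [Prod.mk.injEq, true_and] at h
    exact Prod.ext h.1 h.2
  have h1 := Measure.map_infinitePi_infinitePi_of_inj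
    (P := fun _ : Fin s × Fin T × Fin N => ρ) hinj
  have h2 := Measure.infinitePi_map_curry (ι := Fin s) (κ := Fin N) (fun _ _ => ρ)
  rw [← h1, Measure.map_map (MeasurableEquiv.measurable _) (by fun_prop)] at h2
  simp only [Measure.infinitePi_eq_pi] at h2
  have h3 : (Measure.pi fun _ : Fin s => Measure.pi fun _ : Fin N => ρ) (Set.pi S A)
      = ∏ i ∈ S, (Measure.pi fun _ : Fin N => ρ) (A i) := by
    rw [← Measure.infinitePi_eq_pi, Measure.infinitePi_pi _ fun i _ => hA i]
  rw [← h3, ← h2, Measure.map_apply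
    ((MeasurableEquiv.measurable _).comp (by fun_prop))
    (MeasurableSet.pi S.countable_toSet fun i _ => hA i)]
  rfl

lemma pi_le_count_le {R : Type*} [MeasurableSpace R] (ρ : Measure R) [IsProbabilityMeasure ρ]
    {s T N : ℕ} {A : Fin s → Set (Fin N → R)} (hA : ∀ i, MeasurableSet (A i)) {e : ℝ≥0∞}
    (he : ∀ i, (Measure.pi fun _ : Fin N => ρ) (A i) ≤ e) (t : Fin T) (k : ℕ) :
    (Measure.pi fun _ : Fin s × Fin T × Fin N => ρ)
      {w | k ≤ count fun i => (fun j => w (i, t, j)) ∈ A i} ≤ 2 ^ s * e ^ k := by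
  have hset := setOf_le_count
    (fun i : Fin s => {w : Fin s × Fin T × Fin N → R | (fun j => w (i, t, j)) ∈ A i}) k
  simp only [Set.mem_ofPred_eq] at hset
  rw [hset]
  calc _ ≤ ∑ S ∈ (Finset.univ : Finset (Fin s)).powersetCard k,
        (Measure.pi fun _ : Fin s × Fin T × Fin N => ρ)
          {w | ∀ i ∈ S, (fun j => w (i, t, j)) ∈ A i} := measure_biUnion_finset_le _ _
    _ ≤ ∑ _S ∈ (Finset.univ : Finset (Fin s)).powersetCard k, e ^ k := by
        refine Finset.sum_le_sum fun S hS => ?_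
        rw [pi_block_apply ρ hA t S, ← (Finset.mem_powersetCard.1 hS).2]
        exact Finset.prod_le_pow_card _ _ _ fun i _ => he i
    _ = (s.choose k : ℝ≥0∞) * e ^ k := by simp
    _ ≤ 2 ^ s * e ^ k := by
        gcongr
        exact_mod_cast Nat.choose_le_two_pow s k

lemma measure_mean_deviation_le {R : Type*} [MeasurableSpace R] (ρ : Measure R)
    [IsProbabilityMeasure ρ] {E : Set R} (hE : MeasurableSet E) {N : ℕ} (hN : 0 < N) {γ : ℝ}
    (hγ : 0 < γ) :
    (Measure.pi fun _ : Fin N => ρ)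
      {w | γ ≤ |(N : ℝ)⁻¹ * ∑ j, E.indicator (fun _ => (1 : ℝ)) (w j) - ρ.real E|}
      ≤ ENNReal.ofReal (1 / (N * γ ^ 2)) := by
  set f : R → ℝ := E.indicator fun _ => (1 : ℝ) with hf
  have hfm : Measurable f := measurable_const.indicator hE
  have hf01 (x : R) : f x ∈ Set.Icc (0 : ℝ) 1 := by
    by_cases hx : x ∈ E <;> simp [hf, hx]
  have hfL : MemLp f 2 ρ := MemLp.of_bound hfm.aestronglyMeasurable 1
    (ae_of_all _ fun x => by rw [Real.norm_of_nonneg (hf01 x).1]; exact (hf01 x).2)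
  set μ := Measure.pi fun _ : Fin N => ρ
  have hfjL (j : Fin N) : MemLp (fun w : Fin N → R => f (w j)) 2 μ :=
    hfL.comp_measurePreserving (measurePreserving_eval _ j)
  have hL : MemLp (fun w : Fin N → R => (N : ℝ)⁻¹ * ∑ j, f (w j)) 2 μ :=
    (memLp_finsetSum _ fun j _ => hfjL j).const_mul _
  have hNr : (N : ℝ) ≠ 0 := by exact_mod_cast hN.ne'
  have hmean : ∫ w, (N : ℝ)⁻¹ * ∑ j, f (w j) ∂μ = ρ.real E := by
    rw [integral_const_mul, integral_finsetSum _ fun j _ => (hfjL j).integrable one_le_two]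
    have (j : Fin N) : ∫ w, f (w j) ∂μ = ρ.real E := by
      have h := (measurePreserving_eval (fun _ : Fin N => ρ) j).map_eq
      have h2 : ∫ w, f (w j) ∂μ = ∫ x, f x ∂ρ := by
        conv_rhs => rw [← h]
        rw [integral_map (measurable_pi_apply j).aemeasurable hfm.aestronglyMeasurable]
      rw [h2, hf, integral_indicator_const _ hE]; simp
    simp only [this, Finset.sum_const, Finset.card_univ, Fintype.card_fin, nsmul_eq_mul]
    field_simp
  have hvar : Var[fun w : Fin N → R => (N : ℝ)⁻¹ * ∑ j, f (w j); μ] ≤ (N : ℝ)⁻¹ := by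
    rw [variance_const_mul]
    have h1 := variance_sum_pi (μ := fun _ : Fin N => ρ) (X := fun _ => f) fun _ => hfL
    have h2 : Var[fun w : Fin N → R => ∑ j, f (w j); μ] = ∑ _j : Fin N, Var[f; ρ] := by
      rw [← h1]; congr 1; ext w; simp
    have h3 : Var[f; ρ] ≤ 1 := by
      refine (variance_le_sq_of_bounded (ae_of_all _ hf01) hfm.aemeasurable).trans ?_
      norm_num
    rw [h2]
    simp only [Finset.sum_const, Finset.card_univ, Fintype.card_fin, nsmul_eq_mul]
    calc ((N : ℝ)⁻¹) ^ 2 * (N * Var[f; ρ]) ≤ ((N : ℝ)⁻¹) ^ 2 * (N * 1) := by gcongr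
      _ = (N : ℝ)⁻¹ := by field_simp
  have := meas_ge_le_variance_div_sq hL hγ
  rw [hmean] at this
  refine this.trans (ENNReal.ofReal_le_ofReal ?_)
  calc _ ≤ (N : ℝ)⁻¹ / γ ^ 2 := by gcongr
    _ = 1 / (N * γ ^ 2) := by field_simp

section

variable {𝒳 𝒲 : Type*} [MeasurableSpace 𝒳] [MeasurableSpace 𝒲] {d : ℕ}

lemma isProbabilityMeasure_resampleLaw {m n : ℕ} (hm : 0 < m) :
    IsProbabilityMeasure (resampleLaw m n) := by
  have : Nonempty (Fin m) := ⟨⟨0, hm⟩⟩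
  exact isProbabilityMeasure_uniformOn Set.finite_univ Set.univ_nonempty

lemma measurable_comp_index (m n : ℕ) :
    Measurable fun p : (Fin m → 𝒳) × (Fin n → Fin m) => p.1 ∘ p.2 := by
  refine measurable_from_prod_countable_left fun J => ?_
  exact measurable_pi_lambda _ fun i => measurable_pi_apply (J i)

/-- The exact conditional coverage probability of `I` given the subsample `y`. -/
noncomputable def privCov (ν : Measure 𝒲) (θ : Measure 𝒳 → EuclideanSpace ℝ (Fin d)) {m n : ℕ}
    (θt : (Fin n → 𝒳) → 𝒲 → EuclideanSpace ℝ (Fin d)) (y : Fin m → 𝒳)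
    (I : Set (EuclideanSpace ℝ (Fin d))) : ℝ :=
  ((resampleLaw m n).prod ν).real {q | privBlbStat θ θt y q ∈ I}

variable {m n : ℕ} {ν : Measure 𝒲} [IsProbabilityMeasure ν]
  {θ : Measure 𝒳 → EuclideanSpace ℝ (Fin d)}
  {θt : (Fin n → 𝒳) → 𝒲 → EuclideanSpace ℝ (Fin d)}

lemma measurable_resampled (hθt : Measurable (Function.uncurry θt)) :
    Measurable fun p : (Fin m → 𝒳) × ((Fin n → Fin m) × 𝒲) => θt (p.1 ∘ p.2.1) p.2.2 := by
  have h1 : Measurable fun p : (Fin m → 𝒳) × ((Fin n → Fin m) × 𝒲) => p.1 ∘ p.2.1 :=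
    (measurable_comp_index m n).comp
      (measurable_fst.prodMk (measurable_fst.comp measurable_snd))
  exact hθt.comp (h1.prodMk (measurable_snd.comp measurable_snd))

lemma measurable_privBlbStat (hθ : ∀ n : ℕ, Measurable fun y : Fin n → 𝒳 => θ (empirical y))
    (hθt : Measurable (Function.uncurry θt)) :
    Measurable fun p : (Fin m → 𝒳) × ((Fin n → Fin m) × 𝒲) => privBlbStat θ θt p.1 p.2 := by
  unfold privBlbStat
  exact (((hθ m).comp measurable_fst).sub (measurable_resampled hθt)).const_smul (√(n : ℝ))

lemma measurable_privCov (hθ : ∀ n : ℕ, Measurable fun y : Fin n → 𝒳 => θ (empirical y))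
    (hθt : Measurable (Function.uncurry θt)) {I : Set (EuclideanSpace ℝ (Fin d))}
    (hI : MeasurableSet I) :
    Measurable fun y : Fin m → 𝒳 => privCov ν θ θt y I := by
  have := measurable_measure_prodMk_left (ν := (resampleLaw m n).prod ν)
    (measurable_privBlbStat (m := m) hθ hθt hI)
  exact this.ennreal_toReal

lemma measurable_coverageEst (hθ : ∀ n : ℕ, Measurable fun y : Fin n → 𝒳 => θ (empirical y))
    (hθt : Measurable (Function.uncurry θt)) {I : Set (EuclideanSpace ℝ (Fin d))}
    (hI : MeasurableSet I) (N : ℕ∞) :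
    Measurable fun p : (Fin m → 𝒳) × (Fin N.toNat → (Fin n → Fin m) × 𝒲) =>
      coverageEst ν θ θt N p.1 p.2 I := by
  unfold coverageEst
  split_ifs with h
  · exact (measurable_privCov hθ hθt hI).comp measurable_fst
  · have h2 : Measurable (I.indicator fun _ => (1 : ℝ)) := measurable_const.indicator hI
    have h3 := h2.comp (measurable_privBlbStat (m := m) hθ hθt)
    have h4 (j : Fin N.toNat) :
        Measurable fun p : (Fin m → 𝒳) × (Fin N.toNat → (Fin n → Fin m) × 𝒲) =>
          I.indicator (fun _ => (1 : ℝ)) (privBlbStat θ θt p.1 (p.2 j)) := by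
      have h1 : Measurable fun p : (Fin m → 𝒳) × (Fin N.toNat → (Fin n → Fin m) × 𝒲) =>
          (p.1, p.2 j) := measurable_fst.prodMk ((measurable_pi_apply j).comp measurable_snd)
      have h5 := Measurable.comp h3 h1
      simp only [Function.comp_def] at h5
      exact h5
    exact (Finset.measurable_sum _ fun j _ => h4 j).const_mul _

lemma coverageEst_deviation_le (hm : 0 < m)
    (hθ : ∀ n : ℕ, Measurable fun y : Fin n → 𝒳 => θ (empirical y))
    (hθt : Measurable (Function.uncurry θt)) {I : Set (EuclideanSpace ℝ (Fin d))}
    (hI : MeasurableSet I) {N : ℕ∞} {K : ℕ} (hK : 0 < K) (hKN : (K : ℕ∞) ≤ N) {γ : ℝ}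
    (hγ : 0 < γ) (y : Fin m → 𝒳) :
    (Measure.pi fun _ : Fin N.toNat => (resampleLaw m n).prod ν)
      {r | γ ≤ |coverageEst ν θ θt N y r I - privCov ν θ θt y I|}
      ≤ ENNReal.ofReal (1 / (K * γ ^ 2)) := by
  have := isProbabilityMeasure_resampleLaw (n := n) hm
  by_cases hN : N = ⊤
  · have : {r : Fin N.toNat → (Fin n → Fin m) × 𝒲 |
        γ ≤ |coverageEst ν θ θt N y r I - privCov ν θ θt y I|} = ∅ := by
      ext r
      simp [coverageEst, hN, privCov, hγ]
    rw [this, measure_empty]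
    exact zero_le
  · have hKN' : K ≤ N.toNat := by
      rw [← ENat.natCast_toNat hN] at hKN
      exact_mod_cast hKN
    have hE : MeasurableSet {q | privBlbStat θ θt y q ∈ I} :=
      ((measurable_privBlbStat hθ hθt).comp measurable_prodMk_left) hI
    have := measure_mean_deviation_le ((resampleLaw m n).prod ν) hE (N := N.toNat)
      (hK.trans_le hKN') hγ
    simp only [coverageEst, hN, if_false]
    refine this.trans (ENNReal.ofReal_le_ofReal ?_)
    have : (0 : ℝ) < K := by exact_mod_cast hK
    have : (K : ℝ) ≤ N.toNat := by exact_mod_cast hKN'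
    gcongr

end

lemma two_pow_mul_pow_le {e : ℝ≥0∞} (he : e ≤ (2 ^ 32)⁻¹) (s : ℕ) :
    2 ^ s * e ^ (s / 16 + 1) ≤ (2 ^ s)⁻¹ := by
  have h1 : e ^ (s / 16 + 1) ≤ (2 ^ (s + s))⁻¹ := by
    calc e ^ (s / 16 + 1) ≤ ((2 ^ 32)⁻¹) ^ (s / 16 + 1) := by gcongr
      _ = (2 ^ (32 * (s / 16 + 1)))⁻¹ := by rw [← ENNReal.inv_pow, ← pow_mul]
      _ ≤ (2 ^ (s + s))⁻¹ := by
          rw [ENNReal.inv_le_inv]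
          exact pow_le_pow_right₀ one_le_two (by omega)
  calc 2 ^ s * e ^ (s / 16 + 1) ≤ 2 ^ s * (2 ^ (s + s))⁻¹ := by gcongr
    _ = (2 ^ s)⁻¹ := by
        rw [pow_add, ENNReal.mul_inv (by simp) (by simp), ← mul_assoc,
          ENNReal.mul_inv_cancel (by simp) (by simp), one_mul]

/-! ### The law of a subsample -/

instance (n m : ℕ) : Finite (Splitting n m) :=
  inferInstanceAs (Finite (Fin (n / m) × Fin m ↪ Fin n))

instance (n m : ℕ) : DiscreteMeasurableSpace (Splitting n m) := ⟨fun _ => trivial⟩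

section

variable {𝒳 𝒲 : Type*} [MeasurableSpace 𝒳] [MeasurableSpace 𝒲] {d : ℕ}
  {P : Measure 𝒳} [IsProbabilityMeasure P]

lemma map_subsample {n m : ℕ} (σ : Splitting n m) (i : Fin (n / m)) :
    (dataLaw P).map (fun x => subsample σ x i) = Measure.pi fun _ : Fin m => P := by
  have hinj : Function.Injective fun j : Fin m => (σ.toFun (i, j) : ℕ) := by
    intro j j' h
    have := σ.inj' (Fin.val_injective h)
    exact (Prod.mk.inj this).2
  have := Measure.map_infinitePi_infinitePi_of_inj (P := fun _ : ℕ => P) hinj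
  rw [← Measure.infinitePi_eq_pi]
  exact this

lemma measurable_subsample {n m : ℕ} (i : Fin (n / m)) :
    Measurable fun p : (ℕ → 𝒳) × Splitting n m => subsample p.2 p.1 i := by
  refine measurable_from_prod_countable_left fun σ => ?_
  exact measurable_pi_lambda _ fun j => measurable_pi_apply (σ.toFun (i, j) : ℕ)

lemma measurableSet_subsample_mem {n m : ℕ} (i : Fin (n / m)) {D : Set (Fin m → 𝒳)}
    (hD : MeasurableSet D) :
    MeasurableSet {p : (ℕ → 𝒳) × Splitting n m | subsample p.2 p.1 i ∈ D} :=
  measurable_subsample i hD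

lemma prod_subsample {n m : ℕ} (κ : PMF (Splitting n m)) (i : Fin (n / m))
    {D : Set (Fin m → 𝒳)} (hD : MeasurableSet D) :
    ((dataLaw P).prod κ.toMeasure) {p | subsample p.2 p.1 i ∈ D}
      = (Measure.pi fun _ : Fin m => P) D := by
  rw [Measure.prod_apply_symm (measurableSet_subsample_mem i hD)]
  have (σ : Splitting n m) : dataLaw P ((fun x => (x, σ)) ⁻¹' {p | subsample p.2 p.1 i ∈ D})
      = (Measure.pi fun _ : Fin m => P) D := by
    have hσ : Measurable fun x : ℕ → 𝒳 => subsample σ x i :=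
      (measurable_subsample i).comp measurable_prodMk_right
    rw [← map_subsample (P := P) σ i, Measure.map_apply hσ hD]
    rfl
  simp only [this]
  simp

lemma tendsto_pi_of_ae_tendsto {m : ℕ → ℕ} {κ : (n : ℕ) → PMF (Splitting n (m n))}
    (hpos : ∀ᶠ n in atTop, 0 < n / m n) {D : (n : ℕ) → Set (Fin (m n) → 𝒳)}
    (hD : ∀ n, MeasurableSet (D n))
    (h : ∀ᵐ x ∂(dataLaw P), Tendsto (fun n : ℕ => (κ n).toMeasure
      {σ | ∃ h : 0 < n / m n, subsample σ x ⟨0, h⟩ ∈ D n}) atTop (𝓝 0)) :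
    Tendsto (fun n => (Measure.pi fun _ : Fin (m n) => P) (D n)) atTop (𝓝 0) := by
  have hmeas (n : ℕ) : MeasurableSet {p : (ℕ → 𝒳) × Splitting n (m n) |
      ∃ h : 0 < n / m n, subsample p.2 p.1 ⟨0, h⟩ ∈ D n} := by
    by_cases h0 : 0 < n / m n
    · simp only [h0, exists_true_left]
      exact measurable_subsample _ (hD n)
    · simp [h0]
  have hlim : Tendsto (fun n => ∫⁻ x, (κ n).toMeasure
      {σ | ∃ h : 0 < n / m n, subsample σ x ⟨0, h⟩ ∈ D n} ∂(dataLaw P)) atTop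
      (𝓝 (∫⁻ _, 0 ∂(dataLaw P))) := by
    refine tendsto_lintegral_of_dominated_convergence (fun _ => 1) (fun n => ?_) (fun n => ?_)
      (by simp) h
    · exact measurable_measure_prodMk_left (hmeas n)
    · exact ae_of_all _ fun x => prob_le_one
  rw [lintegral_zero] at hlim
  refine hlim.congr' ?_
  filter_upwards [hpos] with n hn
  rw [← prod_subsample (κ n) ⟨0, hn⟩ (hD n), Measure.prod_apply (measurableSet_subsample_mem _ (hD n))]
  simp [hn, Set.preimage]

lemma prod_count_subsample_le {n m : ℕ} (κ : PMF (Splitting n m))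
    {D : Set (Fin m → 𝒳)} (hD : MeasurableSet D) :
    ((dataLaw P).prod κ.toMeasure)
      {p | n / m / 16 + 1 ≤ count fun i => subsample p.2 p.1 i ∈ D}
      ≤ 16 * (Measure.pi fun _ : Fin m => P) D := by
  set s := n / m
  set e := (Measure.pi fun _ : Fin m => P) D
  have h := measure_le_count_le (μ := (dataLaw P).prod κ.toMeasure)
    (A := fun i : Fin (n / m) => {p | subsample p.2 p.1 i ∈ D})
    (fun i => measurable_subsample i hD) (fun i => (prod_subsample κ i hD).le) (s / 16 + 1)
  have h2 : (s : ℝ≥0∞) * e ≤ ((s / 16 + 1 : ℕ) : ℝ≥0∞) * (16 * e) := by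
    rw [← mul_assoc]
    gcongr
    exact_mod_cast (by omega : s ≤ (s / 16 + 1) * 16)
  exact (ENNReal.mul_le_mul_iff_right (by simp) (by simp)).1 (h.trans h2)

/-! ### Bad subsamples -/

variable {θ : Measure 𝒳 → EuclideanSpace ℝ (Fin d)}

lemma measurable_blbStat (hθ : ∀ n : ℕ, Measurable fun y : Fin n → 𝒳 => θ (empirical y))
    (m n : ℕ) :
    Measurable fun p : (Fin m → 𝒳) × (Fin n → Fin m) => blbStat θ p.1 p.2 := by
  unfold blbStat
  exact (((hθ m).comp measurable_fst).sub ((hθ n).comp (measurable_comp_index m n))).const_smul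
    (√(n : ℝ))

/-- The subsamples whose bootstrap law gives the centered ball of radius `r` a mass which is not
`γ`-close to `g`. -/
def badBoot (θ : Measure 𝒳 → EuclideanSpace ℝ (Fin d)) (m n : ℕ) (r g γ : ℝ) :
    Set (Fin m → 𝒳) :=
  {y | γ ≤ |(resampleLaw m n).real {J | ‖blbStat θ y J‖ ≤ r} - g|}

lemma measurableSet_badBoot (hθ : ∀ n : ℕ, Measurable fun y : Fin n → 𝒳 => θ (empirical y))
    (m n : ℕ) (r g γ : ℝ) : MeasurableSet (badBoot θ m n r g γ) := by
  have h : MeasurableSet {p : (Fin m → 𝒳) × (Fin n → Fin m) | ‖blbStat θ p.1 p.2‖ ≤ r} :=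
    measurableSet_le (measurable_blbStat hθ m n).norm measurable_const
  have h2 := (measurable_measure_prodMk_left (ν := resampleLaw m n) h).ennreal_toReal
  exact measurableSet_le measurable_const (h2.sub_const g).norm

lemma tendsto_badBoot (hθ : ∀ n : ℕ, Measurable fun y : Fin n → 𝒳 => θ (empirical y))
    {m : ℕ → ℕ} {κ : (n : ℕ) → PMF (Splitting n (m n))} (hpos : ∀ᶠ n in atTop, 0 < n / m n)
    {G : Measure (EuclideanSpace ℝ (Fin d))} [IsProbabilityMeasure G]
    (hclt : TendstoInDistribution (fun n : ℕ => centered θ P n) atTop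
      (id : EuclideanSpace ℝ (Fin d) → EuclideanSpace ℝ (Fin d)) (fun _ => dataLaw P) G)
    (hks : KSConsistent P θ m κ) {r : ℝ} (hr : G {v | ‖v‖ = r} = 0) {γ : ℝ} (hγ : 0 < γ) :
    Tendsto (fun n => (Measure.pi fun _ : Fin (m n) => P)
      (badBoot θ (m n) n r (normCDF G r) γ)) atTop (𝓝 0) := by
  refine tendsto_pi_of_ae_tendsto (κ := κ) hpos (fun n => measurableSet_badBoot hθ _ _ _ _ _) ?_
  have hF := hclt.tendsto
  simp only [Measure.map_id] at hF
  obtain ⟨δ, hδ, hev⟩ := exists_ksDist_closedBall hF (r := r) hr hγ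
  filter_upwards [hks] with x hx
  refine tendsto_of_tendsto_of_tendsto_of_le_of_le' tendsto_const_nhds (hx δ hδ)
    (Eventually.of_forall fun n => zero_le) ?_
  filter_upwards [hev, hpos] with n hn hn0
  refine measure_mono ?_
  rintro σ ⟨h, hσ⟩
  refine ⟨h, ?_⟩
  by_contra! hlt
  have hm : 0 < m n := Nat.pos_of_ne_zero fun h0 => by simp [h0] at h
  have := isProbabilityMeasure_resampleLaw (n := n) hm
  have hmeas : Measurable (blbStat (n := n) θ (subsample σ x ⟨0, h⟩)) := measurable_of_finite _
  have h1 := hn _ (Measure.isProbabilityMeasure_map hmeas.aemeasurable) hlt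
  rw [map_measureReal_apply hmeas (measurableSet_le measurable_norm measurable_const)] at h1
  exact absurd hσ (not_le.2 h1)

/-- The subsamples for which the error of the randomized estimator on a resample is not small in
conditional probability. -/
def badNoise (ν : Measure 𝒲) (θ : Measure 𝒳 → EuclideanSpace ℝ (Fin d)) {n : ℕ}
    (θt : (Fin n → 𝒳) → 𝒲 → EuclideanSpace ℝ (Fin d)) (m : ℕ) (δ γ : ℝ) : Set (Fin m → 𝒳) :=
  {y | ENNReal.ofReal γ ≤ ((resampleLaw m n).prod ν)
    {q | δ ≤ ‖√(n : ℝ) • (θt (y ∘ q.1) q.2 - θ (empirical (y ∘ q.1)))‖}}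

lemma measurableSet_resampleError
    (hθ : ∀ n : ℕ, Measurable fun y : Fin n → 𝒳 => θ (empirical y)) {n : ℕ}
    {θt : (Fin n → 𝒳) → 𝒲 → EuclideanSpace ℝ (Fin d)}
    (hθt : Measurable (Function.uncurry θt)) (m : ℕ) (δ : ℝ) :
    MeasurableSet {p : (Fin m → 𝒳) × ((Fin n → Fin m) × 𝒲) |
      δ ≤ ‖√(n : ℝ) • (θt (p.1 ∘ p.2.1) p.2.2 - θ (empirical (p.1 ∘ p.2.1)))‖} := by
  have h1 : Measurable fun p : (Fin m → 𝒳) × ((Fin n → Fin m) × 𝒲) => p.1 ∘ p.2.1 :=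
    (measurable_comp_index m n).comp
      (measurable_fst.prodMk (measurable_fst.comp measurable_snd))
  exact measurableSet_le measurable_const
    (((measurable_resampled hθt).sub ((hθ n).comp h1)).const_smul (√(n : ℝ))).norm

lemma measurableSet_badNoise {ν : Measure 𝒲} [IsProbabilityMeasure ν]
    (hθ : ∀ n : ℕ, Measurable fun y : Fin n → 𝒳 => θ (empirical y)) {n : ℕ}
    {θt : (Fin n → 𝒳) → 𝒲 → EuclideanSpace ℝ (Fin d)}
    (hθt : Measurable (Function.uncurry θt)) (m : ℕ) (δ γ : ℝ) :
    MeasurableSet (badNoise ν θ θt m δ γ) :=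
  measurableSet_le measurable_const
    (measurable_measure_prodMk_left (measurableSet_resampleError hθ hθt m δ))

lemma tendsto_badNoise {ν : ℕ → Measure 𝒲} [∀ n, IsProbabilityMeasure (ν n)]
    (hθ : ∀ n : ℕ, Measurable fun y : Fin n → 𝒳 => θ (empirical y))
    {θt : (n : ℕ) → (Fin n → 𝒳) → 𝒲 → EuclideanSpace ℝ (Fin d)}
    (hθt : ∀ n : ℕ, Measurable (Function.uncurry (θt n)))
    {m : ℕ → ℕ} {κ : (n : ℕ) → PMF (Splitting n (m n))} (hpos : ∀ᶠ n in atTop, 0 < n / m n)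
    (hres : ResamplingConsistent P ν θ θt m κ) {δ γ : ℝ} (hδ : 0 < δ) (hγ : 0 < γ) :
    Tendsto (fun n => (Measure.pi fun _ : Fin (m n) => P)
      (badNoise (ν n) θ (θt n) (m n) δ γ)) atTop (𝓝 0) := by
  refine tendsto_pi_of_ae_tendsto (κ := κ) hpos
    (fun n => measurableSet_badNoise hθ (hθt n) _ _ _) ?_
  filter_upwards [hres.resample] with x hx
  have hγ' : ENNReal.ofReal γ ≠ 0 := by simpa using hγ
  have hx' := ENNReal.Tendsto.const_mul (a := (ENNReal.ofReal γ)⁻¹) (hx δ hδ)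
    (Or.inr (by simpa using hγ))
  rw [mul_zero] at hx'
  refine tendsto_of_tendsto_of_tendsto_of_le_of_le' tendsto_const_nhds hx'
    (Eventually.of_forall fun n => zero_le) ?_
  filter_upwards [hpos] with n hn
  simp only [hn, exists_true_left]
  have hm : MeasurableSet {r : Splitting n (m n) × (Fin n → Fin (m n)) × 𝒲 |
      δ ≤ ‖√(n : ℝ) • (θt n (subsample r.1 x ⟨0, hn⟩ ∘ r.2.1) r.2.2
          - θ (empirical (subsample r.1 x ⟨0, hn⟩ ∘ r.2.1)))‖} := by
    have h1 : Measurable fun σ : Splitting n (m n) => subsample σ x ⟨0, hn⟩ :=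
      Measurable.of_discrete
    have h2 : Measurable fun r : Splitting n (m n) × (Fin n → Fin (m n)) × 𝒲 =>
        (subsample r.1 x ⟨0, hn⟩, r.2) := (h1.comp measurable_fst).prodMk measurable_snd
    exact h2 (measurableSet_resampleError hθ (hθt n) (m n) δ)
  rw [Measure.prod_apply hm, mul_comm, ← div_eq_mul_inv,
    ENNReal.le_div_iff_mul_le (Or.inl hγ') (Or.inl ENNReal.ofReal_ne_top), mul_comm]
  exact mul_meas_ge_le_lintegral Measurable.of_discrete _

end

/-! ### The returned index on the good event -/

lemma blbStat_eq_privBlbStat_add {𝒳 𝒲 : Type*} [MeasurableSpace 𝒳] {d m n : ℕ}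
    {θ : Measure 𝒳 → EuclideanSpace ℝ (Fin d)} (θt : (Fin n → 𝒳) → 𝒲 → EuclideanSpace ℝ (Fin d))
    (y : Fin m → 𝒳) (q : (Fin n → Fin m) × 𝒲) :
    blbStat θ y q.1 = privBlbStat θ θt y q
      + √(n : ℝ) • (θt (y ∘ q.1) q.2 - θ (empirical (y ∘ q.1))) := by
  unfold blbStat privBlbStat
  rw [← smul_add]
  congr 1
  abel

section

variable {𝒳 𝒲 : Type*} [MeasurableSpace 𝒳] [MeasurableSpace 𝒲] {d : ℕ}
  {θ : Measure 𝒳 → EuclideanSpace ℝ (Fin d)}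

section

variable {m n : ℕ} {ν : Measure 𝒲} [IsProbabilityMeasure ν]
  {θt : (Fin n → 𝒳) → 𝒲 → EuclideanSpace ℝ (Fin d)} {δ γ : ℝ} {y : Fin m → 𝒳}

lemma prod_real_blbStat (r : ℝ) :
    ((resampleLaw m n).prod ν).real {q | ‖blbStat θ y q.1‖ ≤ r}
      = (resampleLaw m n).real {J | ‖blbStat θ y J‖ ≤ r} := by
  have : {q : (Fin n → Fin m) × 𝒲 | ‖blbStat θ y q.1‖ ≤ r}
      = {J | ‖blbStat θ y J‖ ≤ r} ×ˢ Set.univ := by ext; simp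
  rw [this, measureReal_prod_prod]
  simp

lemma real_lt_of_notMem_badNoise (hy : y ∉ badNoise ν θ θt m δ γ) :
    ((resampleLaw m n).prod ν).real
      {q | δ ≤ ‖√(n : ℝ) • (θt (y ∘ q.1) q.2 - θ (empirical (y ∘ q.1)))‖} < γ := by
  simp only [badNoise, Set.mem_ofPred_eq, not_le] at hy
  have := (ENNReal.lt_ofReal_iff_toReal_lt (measure_ne_top _ _)).1 hy
  exact this

lemma privCov_le {a g r : ℝ} (hy : y ∉ badBoot θ m n a g γ) (hy' : y ∉ badNoise ν θ θt m δ γ)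
    {I : Set (EuclideanSpace ℝ (Fin d))} (hI : ∀ u ∈ I, ‖u‖ ≤ r) (hr : r + δ ≤ a) :
    privCov ν θ θt y I ≤ g + 2 * γ := by
  simp only [badBoot, Set.mem_ofPred_eq, not_le, abs_lt] at hy
  have h2 := real_lt_of_notMem_badNoise hy'
  have hsub : {q | privBlbStat θ θt y q ∈ I} ⊆ {q | ‖blbStat θ y q.1‖ ≤ a} ∪
      {q | δ ≤ ‖√(n : ℝ) • (θt (y ∘ q.1) q.2 - θ (empirical (y ∘ q.1)))‖} := by
    intro q hq
    by_cases h : δ ≤ ‖√(n : ℝ) • (θt (y ∘ q.1) q.2 - θ (empirical (y ∘ q.1)))‖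
    · exact Or.inr h
    · left
      change ‖blbStat θ y q.1‖ ≤ a
      rw [blbStat_eq_privBlbStat_add θt y q]
      refine (norm_add_le _ _).trans ?_
      linarith [hI _ hq, not_le.1 h]
  have h3 := (measureReal_mono (μ := (resampleLaw m n).prod ν) hsub).trans
    (measureReal_union_le _ _)
  rw [prod_real_blbStat] at h3
  unfold privCov
  linarith [hy.1, hy.2]

lemma le_privCov {b g r : ℝ} (hy : y ∉ badBoot θ m n b g γ) (hy' : y ∉ badNoise ν θ θt m δ γ)
    {I : Set (EuclideanSpace ℝ (Fin d))} (hI : ∀ u, ‖u‖ ≤ r → u ∈ I) (hr : b + δ ≤ r) :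
    g - 2 * γ ≤ privCov ν θ θt y I := by
  simp only [badBoot, Set.mem_ofPred_eq, not_le, abs_lt] at hy
  have h2 := real_lt_of_notMem_badNoise hy'
  have hsub : {q | ‖blbStat θ y q.1‖ ≤ b} ⊆ {q | privBlbStat θ θt y q ∈ I} ∪
      {q | δ ≤ ‖√(n : ℝ) • (θt (y ∘ q.1) q.2 - θ (empirical (y ∘ q.1)))‖} := by
    intro q hq
    by_cases h : δ ≤ ‖√(n : ℝ) • (θt (y ∘ q.1) q.2 - θ (empirical (y ∘ q.1)))‖
    · exact Or.inr h
    · left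
      refine hI _ ?_
      rw [eq_sub_of_add_eq (blbStat_eq_privBlbStat_add θt y q).symm]
      refine (norm_sub_le _ _).trans ?_
      have : ‖blbStat θ y q.1‖ ≤ b := hq
      linarith [not_le.1 h]
  have h3 := (measureReal_mono (μ := (resampleLaw m n).prod ν) hsub).trans
    (measureReal_union_le _ _)
  rw [prod_real_blbStat] at h3
  unfold privCov
  linarith [hy.1, hy.2]

end

lemma card_filter_eq_count {k : ℕ} (p : Fin k → Prop) [DecidablePred p] :
    (Finset.univ.filter p).card = count p := by
  unfold count
  congr

/-- The deviation of the coverage estimate for the `i`-th subsample and the `t`-th set from the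
exact conditional coverage is at least `γ`. -/
def Deviates (ν : Measure 𝒲) (θ : Measure 𝒳 → EuclideanSpace ℝ (Fin d)) {n m : ℕ}
    (θt : (Fin n → 𝒳) → 𝒲 → EuclideanSpace ℝ (Fin d)) (N : ℕ∞) (γ : ℝ) (x : ℕ → 𝒳)
    (σ : Splitting n m) (w : Fin (n / m) × Fin n × Fin N.toNat → (Fin n → Fin m) × 𝒲)
    (t : Fin n) (i : Fin (n / m)) : Prop :=
  γ ≤ |coverageEst ν θ θt N (subsample σ x i) (fun j => w (i, t, j)) (ballSet d t)
    - privCov ν θ θt (subsample σ x i) (ballSet d t)|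

lemma exists_blbQuant {ν : Measure 𝒲} {n m : ℕ}
    {θt : (Fin n → 𝒳) → 𝒲 → EuclideanSpace ℝ (Fin d)} {N : ℕ∞} {α γ : ℝ}
    (o : Outcome 𝒳 𝒲 n m N) (hs : 8 ≤ n / m)
    (h₀ : |o.xi0 - ((n / m : ℕ) : ℝ) / 2| ≤ ((n / m : ℕ) : ℝ) / 8)
    (hξ : ∀ t, |o.xi t| ≤ ((n / m : ℕ) : ℝ) / 8) {D : Set (Fin m → 𝒳)}
    (hD : count (fun i => subsample o.splitting o.data i ∈ D) < n / m / 16 + 1)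
    (hdev : ∀ t, count (Deviates ν θ θt N γ o.data o.splitting o.draws t) < n / m / 16 + 1)
    {rej : Fin n → Prop}
    (hrej : ∀ t, rej t → ∀ y ∉ D, privCov ν θ θt y (ballSet d t) ≤ 1 - α - γ)
    {t₁ : Fin n} (ht₁ : ∀ y ∉ D, 1 - α + γ ≤ privCov ν θ θt y (ballSet d t₁)) :
    ∃ t : Fin n, blbQuant ν θ θt N α o = t ∧ t ≤ t₁ ∧ ¬ rej t := by
  have key (t : Fin n) {p : Fin (n / m) → Prop} (hp : ∀ i, p i →
      subsample o.splitting o.data i ∈ D ∨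
        Deviates ν θ θt N γ o.data o.splitting o.draws t i) :
      8 * (count p : ℝ) ≤ ((n / m : ℕ) : ℝ) := by
    have h1 := (count_mono hp).trans (count_or_le _ _)
    have h2 := hdev t
    exact_mod_cast (by omega : 8 * count p ≤ n / m)
  refine exists_aboveThr_of_count hs h₀ hξ (rej := rej) (fun t ht => ?_) ?_
  · rw [card_filter_eq_count]
    refine key t fun i hi => or_iff_not_imp_left.2 fun hy => ?_
    have h1 := hrej t ht _ hy
    exact le_trans (by linarith) (le_abs_self _)
  · rw [card_filter_eq_count]
    refine key t₁ fun i hi => or_iff_not_imp_left.2 fun hy => ?_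
    have h1 := ht₁ _ hy
    exact le_trans (by linarith) (neg_le_abs _)

lemma mem_confSet_iff {ν : Measure 𝒲} {P : Measure 𝒳} {n m : ℕ} (hn : 0 < n)
    {θt : (Fin n → 𝒳) → 𝒲 → EuclideanSpace ℝ (Fin d)} {N : ℕ∞} {α : ℝ}
    {Inone : Set (EuclideanSpace ℝ (Fin d))} {o : Outcome 𝒳 𝒲 n m N} {t : Fin n}
    (ht : blbQuant ν θ θt N α o = t) :
    θ P ∈ confSet ν θ θt N α Inone o ↔
      ‖√(n : ℝ) • (θ P - θt (sample n o.data) o.noise)‖ ≤ ((t : ℝ) + 1) / √(n : ℝ) := by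
  have hsq : √(n : ℝ) ≠ 0 := by positivity
  unfold confSet
  rw [ht]
  constructor
  · rintro ⟨u, hu, h⟩
    rw [← h]
    have hu' : ‖u‖ ≤ ((t : ℝ) + 1) / √(n : ℝ) := hu
    simpa [smul_smul, hsq] using hu'
  · intro h
    refine ⟨√(n : ℝ) • (θ P - θt (sample n o.data) o.noise), h, ?_⟩
    simp [smul_smul, hsq]

/-- An index whose radius is just below a prescribed one. -/
lemma exists_index {q η : ℝ} (hq : 0 < q) (hη : 0 < η) :
    ∀ᶠ n : ℕ in atTop, ∃ t : Fin n,
      q + η / 2 ≤ ((t : ℝ) + 1) / √(n : ℝ) ∧ ((t : ℝ) + 1) / √(n : ℝ) ≤ q + η := by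
  have hlim : Tendsto (fun n : ℕ => √(n : ℝ)) atTop atTop :=
    Real.tendsto_sqrt_atTop.comp tendsto_natCast_atTop_atTop
  filter_upwards [hlim.eventually_ge_atTop (q + η), hlim.eventually_ge_atTop (2 / η),
    hlim.eventually_ge_atTop (1 / (q + η)), eventually_gt_atTop 0] with n h1 h2 h3 hn
  have hs : 0 < √(n : ℝ) := by positivity
  have hsq : √(n : ℝ) * √(n : ℝ) = n := Real.mul_self_sqrt (by positivity)
  set T := ⌊(q + η) * √(n : ℝ)⌋₊ with hT
  have hT1 : 1 ≤ T := Nat.le_floor (by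
    rw [div_le_iff₀ (by linarith)] at h3
    push_cast; linarith)
  have hTn : T ≤ n := Nat.floor_le_of_le (by nlinarith)
  have hTle : (T : ℝ) ≤ (q + η) * √(n : ℝ) := Nat.floor_le (by positivity)
  have hTlt : (q + η) * √(n : ℝ) < T + 1 := Nat.lt_floor_add_one _
  refine ⟨⟨T - 1, by omega⟩, ?_, ?_⟩
  · rw [le_div_iff₀ hs]
    have : (((T - 1 : ℕ) : ℝ) + 1) = T := by exact_mod_cast Nat.sub_add_cancel hT1
    simp only [this]
    rw [div_le_iff₀ hη] at h2
    nlinarith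
  · rw [div_le_iff₀ hs]
    have : (((T - 1 : ℕ) : ℝ) + 1) = T := by exact_mod_cast Nat.sub_add_cancel hT1
    simp only [this]
    exact hTle

end

/-! ### The probability of the bad events in one run -/

lemma prod_le_of_forall_le {A B : Type*} [MeasurableSpace A] [MeasurableSpace B]
    {μ : Measure A} [IsProbabilityMeasure μ] {ρ : Measure B} [SFinite ρ] {S : Set (A × B)}
    (hS : MeasurableSet S) {c : ℝ≥0∞} (h : ∀ a, ρ {b | (a, b) ∈ S} ≤ c) : μ.prod ρ S ≤ c := by
  rw [Measure.prod_apply hS]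
  calc ∫⁻ a, ρ (Prod.mk a ⁻¹' S) ∂μ ≤ ∫⁻ _, c ∂μ := lintegral_mono h
    _ = c := by simp

section

variable {𝒳 𝒲 : Type*} [MeasurableSpace 𝒳] [MeasurableSpace 𝒲] {d : ℕ}
  {P : Measure 𝒳} [IsProbabilityMeasure P] {θ : Measure 𝒳 → EuclideanSpace ℝ (Fin d)}
  {n m : ℕ} {ν : Measure 𝒲} [IsProbabilityMeasure ν]
  {θt : (Fin n → 𝒳) → 𝒲 → EuclideanSpace ℝ (Fin d)}

lemma measurableSet_ballSet (t : Fin n) : MeasurableSet (ballSet d t) :=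
  measurableSet_le measurable_norm measurable_const

lemma measurableSet_deviates (hθ : ∀ n : ℕ, Measurable fun y : Fin n → 𝒳 => θ (empirical y))
    (hθt : Measurable (Function.uncurry θt)) (N : ℕ∞) (γ : ℝ) (t : Fin n) (i : Fin (n / m)) :
    MeasurableSet {p : (ℕ → 𝒳) × Splitting n m ×
      (Fin (n / m) × Fin n × Fin N.toNat → (Fin n → Fin m) × 𝒲) |
        Deviates ν θ θt N γ p.1 p.2.1 p.2.2 t i} := by
  have h1 : Measurable fun p : (ℕ → 𝒳) × Splitting n m ×
      (Fin (n / m) × Fin n × Fin N.toNat → (Fin n → Fin m) × 𝒲) => subsample p.2.1 p.1 i :=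
    (measurable_subsample i).comp (measurable_fst.prodMk (measurable_fst.comp measurable_snd))
  have h2 : Measurable fun p : (ℕ → 𝒳) × Splitting n m ×
      (Fin (n / m) × Fin n × Fin N.toNat → (Fin n → Fin m) × 𝒲) => fun j => p.2.2 (i, t, j) :=
    measurable_pi_lambda _ fun j =>
      (measurable_pi_apply (i, t, j)).comp (measurable_snd.comp measurable_snd)
  have hc := measurable_coverageEst (m := m) (ν := ν) hθ hθt (measurableSet_ballSet (d := d) t) N
  have hp := measurable_privCov (m := m) (ν := ν) hθ hθt (measurableSet_ballSet (d := d) t)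
  have h3 := Measurable.comp hc (h1.prodMk h2)
  have h4 := Measurable.comp hp h1
  simp only [Function.comp_def] at h3 h4
  exact measurableSet_le measurable_const (h3.sub h4).norm

lemma prod_deviates_le (hm : 0 < m)
    (hθ : ∀ n : ℕ, Measurable fun y : Fin n → 𝒳 => θ (empirical y))
    (hθt : Measurable (Function.uncurry θt)) (κ : PMF (Splitting n m)) {N : ℕ∞} {γ : ℝ}
    (hγ : 0 < γ) {K : ℕ} (hK : 0 < K) (hKN : (K : ℕ∞) ≤ N)
    (hKγ : ENNReal.ofReal (1 / (K * γ ^ 2)) ≤ (2 ^ 32)⁻¹) :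
    ((dataLaw P).prod (κ.toMeasure.prod
      (Measure.pi fun _ : Fin (n / m) × Fin n × Fin N.toNat => (resampleLaw m n).prod ν)))
      {p | ∃ t, n / m / 16 + 1 ≤ count (Deviates ν θ θt N γ p.1 p.2.1 p.2.2 t)}
      ≤ n * (2 ^ (n / m))⁻¹ := by
  have := isProbabilityMeasure_resampleLaw (n := n) hm
  have hmeas : MeasurableSet {p : (ℕ → 𝒳) × Splitting n m ×
      (Fin (n / m) × Fin n × Fin N.toNat → (Fin n → Fin m) × 𝒲) |
        ∃ t, n / m / 16 + 1 ≤ count (Deviates ν θ θt N γ p.1 p.2.1 p.2.2 t)} := by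
    simp only [Set.ofPred_exists]
    exact MeasurableSet.iUnion fun t =>
      measurableSet_le_count (fun i => measurableSet_deviates hθ hθt N γ t i) _
  refine prod_le_of_forall_le hmeas fun x => ?_
  refine prod_le_of_forall_le (measurable_prodMk_left hmeas) fun σ => ?_
  have hset : {w | (σ, w) ∈ Prod.mk x ⁻¹' {p : (ℕ → 𝒳) × Splitting n m ×
      (Fin (n / m) × Fin n × Fin N.toNat → (Fin n → Fin m) × 𝒲) |
        ∃ t, n / m / 16 + 1 ≤ count (Deviates ν θ θt N γ p.1 p.2.1 p.2.2 t)}}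
      = ⋃ t, {w | n / m / 16 + 1 ≤ count (Deviates ν θ θt N γ x σ w t)} := by
    ext w; simp
  change (Measure.pi fun _ : Fin (n / m) × Fin n × Fin N.toNat => (resampleLaw m n).prod ν)
    {w | (σ, w) ∈ Prod.mk x ⁻¹' _} ≤ _
  rw [hset]
  refine (measure_iUnion_fintype_le _ _).trans ?_
  calc _ ≤ ∑ _t : Fin n, ((2 : ℝ≥0∞) ^ (n / m))⁻¹ := by
        refine Finset.sum_le_sum fun t _ => ?_
        refine le_trans ?_ (two_pow_mul_pow_le hKγ (n / m))
        refine pi_le_count_le ((resampleLaw m n).prod ν) (A := fun i =>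
          {r | γ ≤ |coverageEst ν θ θt N (subsample σ x i) r (ballSet d t)
            - privCov ν θ θt (subsample σ x i) (ballSet d t)|}) (fun i => ?_) (fun i => ?_) t _
        · have hc := measurable_coverageEst (m := m) (ν := ν) hθ hθt
            (measurableSet_ballSet (d := d) t) N
          have h3 := Measurable.comp hc (measurable_prodMk_left (x := subsample σ x i))
          simp only [Function.comp_def] at h3
          exact measurableSet_le measurable_const (h3.sub_const _).norm
        · exact coverageEst_deviation_le hm hθ hθt (measurableSet_ballSet t) hK hKN hγ _
    _ = n * (2 ^ (n / m))⁻¹ := by simp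

/-- The event that some Laplace noise of the run is large. -/
def noiseEvent (s T : ℕ) : Set (ℝ × (Fin T → ℝ)) :=
  {p | (s : ℝ) / 8 < |p.1 - (s : ℝ) / 2| ∨ ∃ t, (s : ℝ) / 8 < |p.2 t|}

lemma prod_noiseEvent_le {ε β : ℝ} (hε : 0 < ε) (hβ : 0 < β) {s T : ℕ} (hT : 0 < T)
    (hs : 32 * (1 / ε * Real.log (8 * T / (3 * β))) < s) :
    ((laplace ((s : ℝ) / 2) (2 / ε)).prod (Measure.pi fun _ : Fin T => laplace 0 (4 / ε)))
      (noiseEvent s T) ≤ ENNReal.ofReal β := by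
  have hp0 := isProbabilityMeasure_laplace ((s : ℝ) / 2) (b := 2 / ε) (by positivity)
  have hp1 := isProbabilityMeasure_laplace 0 (b := 4 / ε) (by positivity)
  have hT' : (0 : ℝ) < T := by exact_mod_cast hT
  have hT1 : (1 : ℝ) ≤ T := by exact_mod_cast hT
  have hs0 : (0 : ℝ) ≤ s := by positivity
  have hlog : Real.log (8 * T / (3 * β)) ≤ s * ε / 32 := by
    have : 32 * (1 / ε * Real.log (8 * T / (3 * β))) * ε
        = 32 * Real.log (8 * T / (3 * β)) := by field_simp
    nlinarith
  have hexp : Real.exp (-(s * ε / 32)) ≤ 3 * β / (8 * T) := by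
    have h := Real.exp_le_exp.2 (neg_le_neg hlog)
    rwa [Real.exp_neg (Real.log _), Real.exp_log (by positivity), inv_div] at h
  have hexp0 : Real.exp (-((s : ℝ) / 8) / (2 / ε)) ≤ 3 * β / (8 * T) := by
    refine le_trans (Real.exp_le_exp.2 ?_) hexp
    have : -((s : ℝ) / 8) / (2 / ε) = -(s * ε / 16) := by field_simp; ring
    rw [this]
    have : 0 ≤ s * ε := by positivity
    linarith
  have hexp1 : Real.exp (-((s : ℝ) / 8) / (4 / ε)) ≤ 3 * β / (8 * T) := by
    have : -((s : ℝ) / 8) / (4 / ε) = -(s * ε / 32) := by field_simp; ring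
    rw [this]; exact hexp
  have h0 : ((laplace ((s : ℝ) / 2) (2 / ε)).prod (Measure.pi fun _ : Fin T => laplace 0 (4 / ε)))
      {p | (s : ℝ) / 8 < |p.1 - (s : ℝ) / 2|} ≤ ENNReal.ofReal (3 * β / (8 * T)) := by
    have hmp := measurePreserving_fst (μ := laplace ((s : ℝ) / 2) (2 / ε))
      (ν := Measure.pi fun _ : Fin T => laplace 0 (4 / ε))
    have := hmp.measure_preimage (s := {x | (s : ℝ) / 8 < |x - (s : ℝ) / 2|})
      (measurableSet_lt measurable_const (by fun_prop)).nullMeasurableSet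
    rw [laplace_tail _ (by positivity) (by positivity)] at this
    exact this.le.trans (ENNReal.ofReal_le_ofReal hexp0)
  have h1 (t : Fin T) : ((laplace ((s : ℝ) / 2) (2 / ε)).prod
      (Measure.pi fun _ : Fin T => laplace 0 (4 / ε)))
      {p | (s : ℝ) / 8 < |p.2 t|} ≤ ENNReal.ofReal (3 * β / (8 * T)) := by
    have hmp := (measurePreserving_eval (fun _ : Fin T => laplace 0 (4 / ε)) t).comp
      (measurePreserving_snd (μ := laplace ((s : ℝ) / 2) (2 / ε))
        (ν := Measure.pi fun _ : Fin T => laplace 0 (4 / ε)))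
    have := hmp.measure_preimage (s := {x | (s : ℝ) / 8 < |x - 0|})
      (measurableSet_lt measurable_const (by fun_prop)).nullMeasurableSet
    rw [laplace_tail _ (by positivity) (by positivity)] at this
    simp only [sub_zero] at this
    exact this.le.trans (ENNReal.ofReal_le_ofReal hexp1)
  have hsplit : noiseEvent s T = {p | (s : ℝ) / 8 < |p.1 - (s : ℝ) / 2|} ∪
      ⋃ t, {p | (s : ℝ) / 8 < |p.2 t|} := by
    ext p; simp [noiseEvent]
  rw [hsplit]
  refine (measure_union_le _ _).trans ((add_le_add h0 ((measure_iUnion_fintype_le _ _).trans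
    (Finset.sum_le_sum fun t _ => h1 t))).trans ?_)
  rw [Finset.sum_const, Finset.card_univ, Fintype.card_fin, nsmul_eq_mul,
    ← ENNReal.ofReal_natCast, ← ENNReal.ofReal_mul (by positivity),
    ← ENNReal.ofReal_add (by positivity) (by positivity)]
  refine ENNReal.ofReal_le_ofReal ?_
  have e1 : (T : ℝ) * (3 * β / (8 * T)) = 3 * β / 8 := by field_simp
  have e2 : 3 * β / (8 * T) ≤ 3 * β / 8 :=
    div_le_div_of_nonneg_left (by positivity) (by norm_num) (by linarith)
  linarith

lemma natCast_mul_inv_two_pow_le {β : ℝ} (hβ : 0 < β) {s T : ℕ} (hT : 0 < T)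
    (hs : 32 * Real.log (2 * T / β) < s) :
    (T : ℝ≥0∞) * (2 ^ s)⁻¹ ≤ ENNReal.ofReal β := by
  have hT' : (0 : ℝ) < T := by exact_mod_cast hT
  have hs0 : (0 : ℝ) ≤ s := by positivity
  have h1 : 2 * T / β ≤ (2 : ℝ) ^ s := by
    rw [← Real.log_le_log_iff (by positivity) (by positivity), Real.log_pow]
    have := Real.log_two_gt_d9
    nlinarith
  have h2 : (T : ℝ) * (2 ^ s)⁻¹ ≤ β := by
    rw [← div_eq_mul_inv, div_le_iff₀ (by positivity)]
    rw [div_le_iff₀ hβ] at h1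
    linarith
  refine le_trans (le_of_eq ?_) (ENNReal.ofReal_le_ofReal h2)
  rw [ENNReal.ofReal_mul (by positivity), ENNReal.ofReal_natCast,
    ENNReal.ofReal_inv_of_pos (by positivity), ENNReal.ofReal_pow (by norm_num)]
  simp

/-! ### Projections of the law of one run -/

variable (P ν) (κ : PMF (Splitting n m)) (N : ℕ∞) {ε : ℝ}

lemma isProbabilityMeasure_runLaw (hm : 0 < m) (hε : 0 < ε) :
    IsProbabilityMeasure (runLaw P ν n m κ N ε) := by
  have := isProbabilityMeasure_resampleLaw (n := n) hm
  have := isProbabilityMeasure_laplace (((n / m : ℕ) : ℝ) / 2) (b := 2 / ε) (by positivity)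
  have := isProbabilityMeasure_laplace 0 (b := 4 / ε) (by positivity)
  unfold runLaw
  infer_instance

lemma measurePreserving_runLaw (hm : 0 < m) (hε : 0 < ε) :
    MeasurePreserving (fun p => (p.1, p.2.1)) (runLaw P ν n m κ N ε)
        ((dataLaw P).prod κ.toMeasure) ∧
      MeasurePreserving (fun p => (p.1, p.2.1, p.2.2.1)) (runLaw P ν n m κ N ε)
        ((dataLaw P).prod (κ.toMeasure.prod
          (Measure.pi fun _ : Fin (n / m) × Fin n × Fin N.toNat =>
            (resampleLaw m n).prod ν))) ∧
      MeasurePreserving (fun p => (p.1, p.2.2.2.1)) (runLaw P ν n m κ N ε)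
        ((dataLaw P).prod ν) ∧
      MeasurePreserving (fun p => p.2.2.2.2) (runLaw P ν n m κ N ε)
        ((laplace (((n / m : ℕ) : ℝ) / 2) (2 / ε)).prod
          (Measure.pi fun _ : Fin n => laplace 0 (4 / ε))) := by
  have := isProbabilityMeasure_resampleLaw (n := n) hm
  have := isProbabilityMeasure_laplace (((n / m : ℕ) : ℝ) / 2) (b := 2 / ε) (by positivity)
  have := isProbabilityMeasure_laplace 0 (b := 4 / ε) (by positivity)
  unfold runLaw
  refine ⟨(MeasurePreserving.id _).prod measurePreserving_fst,
    (MeasurePreserving.id _).prod ((MeasurePreserving.id _).prod measurePreserving_fst),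
    (MeasurePreserving.id _).prod
      (measurePreserving_fst.comp (measurePreserving_snd.comp measurePreserving_snd)), ?_⟩
  exact measurePreserving_snd.comp (measurePreserving_snd.comp
    (measurePreserving_snd.comp measurePreserving_snd))

end

/-! ### Localization of the returned radius -/

lemma eventually_le_numSubsamples {β s : ℕ → ℝ} (hβ : ∀ n, 0 < β n)
    (hβ0 : Tendsto β atTop (𝓝 0)) (hs : ∀ᶠ n : ℕ in atTop, 32 * Real.log (2 * n / β n) < s n) :
    ∀ᶠ n in atTop, 32 ≤ s n := by
  filter_upwards [hs, hβ0.eventually (gt_mem_nhds (show (0 : ℝ) < 1 / 2 by norm_num)),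
    eventually_ge_atTop 1] with n h1 h2 h3
  have h3' : (1 : ℝ) ≤ n := by exact_mod_cast h3
  have h4 : Real.exp 1 ≤ 2 * n / β n := by
    rw [le_div_iff₀ (hβ n)]
    nlinarith [Real.exp_one_lt_d9, Real.exp_pos 1, hβ n]
  have h5 : 1 ≤ Real.log (2 * n / β n) := by
    rwa [Real.le_log_iff_exp_le (div_pos (by linarith) (hβ n))]
  linarith

lemma exists_natCast_bound {γ : ℝ} (hγ : 0 < γ) :
    ∃ K : ℕ, 0 < K ∧ ENNReal.ofReal (1 / (K * γ ^ 2)) ≤ (2 ^ 32)⁻¹ := by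
  obtain ⟨K, hK⟩ := exists_nat_ge (2 ^ 32 / γ ^ 2)
  have hK0 : (0 : ℝ) < K := lt_of_lt_of_le (by positivity) hK
  refine ⟨K, by exact_mod_cast hK0, ?_⟩
  have h1 : 1 / (K * γ ^ 2) ≤ ((2 : ℝ) ^ 32)⁻¹ := by
    rw [one_div]
    gcongr
    rwa [div_le_iff₀ (by positivity)] at hK
  refine (ENNReal.ofReal_le_ofReal h1).trans (le_of_eq ?_)
  rw [ENNReal.ofReal_inv_of_pos (by positivity), ENNReal.ofReal_pow (by norm_num)]
  simp

lemma measurable_centered {𝒳 : Type*} [MeasurableSpace 𝒳] {d : ℕ} {P : Measure 𝒳}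
    {θ : Measure 𝒳 → EuclideanSpace ℝ (Fin d)}
    (hθ : ∀ n : ℕ, Measurable fun y : Fin n → 𝒳 => θ (empirical y))
    (n : ℕ) : Measurable (centered θ P n) := by
  have h : Measurable fun x : ℕ → 𝒳 => sample n x :=
    measurable_pi_lambda _ fun i => measurable_pi_apply (i : ℕ)
  unfold centered
  exact (measurable_const.sub ((hθ n).comp h)).const_smul (√(n : ℝ))

section

variable {𝒳 𝒲 : Type*} [MeasurableSpace 𝒳] [MeasurableSpace 𝒲] {d : ℕ}
  {P : Measure 𝒳} [IsProbabilityMeasure P] {ν : ℕ → Measure 𝒲} [∀ n, IsProbabilityMeasure (ν n)]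
  {θ : Measure 𝒳 → EuclideanSpace ℝ (Fin d)}
  {θt : (n : ℕ) → (Fin n → 𝒳) → 𝒲 → EuclideanSpace ℝ (Fin d)}

/-- Outside an event of vanishing probability the radius returned by the procedure is close to the
quantile `q` of the norm of the limit. -/
theorem exists_localizing_event
    (hθ : ∀ n : ℕ, Measurable fun y : Fin n → 𝒳 => θ (empirical y))
    (hθt : ∀ n : ℕ, Measurable (Function.uncurry (θt n)))
    {G : Measure (EuclideanSpace ℝ (Fin d))} [IsProbabilityMeasure G]
    (hG : ∀ r, G {v | ‖v‖ = r} = 0) {α q η : ℝ} (hq : 0 < q) (hη : 0 < η)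
    (hlo : normCDF G (q - η / 2) < 1 - α) (hhi : 1 - α < normCDF G (q + η / 4))
    {m : ℕ → ℕ} {κ : (n : ℕ) → PMF (Splitting n (m n))}
    {N : ℕ → ℕ∞} (hN : Tendsto N atTop (𝓝 ⊤))
    {ε β : ℕ → ℝ} (hε : ∀ n, 0 < ε n) (hβ : ∀ n, 0 < β n) (hβ0 : Tendsto β atTop (𝓝 0))
    (hs : ∀ᶠ n : ℕ in atTop,
      32 * max (1 / ε n * Real.log (8 * n / (3 * β n))) (Real.log (2 * n / β n))
        < ((n / m n : ℕ) : ℝ))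
    (hpos : ∀ᶠ n in atTop, 32 ≤ n / m n)
    (hclt : TendstoInDistribution (fun n : ℕ => centered θ P n) atTop
      (id : EuclideanSpace ℝ (Fin d) → EuclideanSpace ℝ (Fin d)) (fun _ => dataLaw P) G)
    (hks : KSConsistent P θ m κ) (hres : ResamplingConsistent P ν θ θt m κ) :
    ∃ B : (n : ℕ) → Set ((ℕ → 𝒳) × Splitting n (m n) × (Fin (n / m n) × Fin n × Fin (N n).toNat →
        (Fin n → Fin (m n)) × 𝒲) × 𝒲 × ℝ × (Fin n → ℝ)),
      Tendsto (fun n => runLaw P (ν n) n (m n) (κ n) (N n) (ε n) (B n)) atTop (𝓝 0) ∧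
      ∀ᶠ n in atTop, ∀ p ∉ B n, ∃ t : Fin n,
        blbQuant (ν n) θ (θt n) (N n) α (Outcome.ofTuple p) = t ∧
          q - η < ((t : ℝ) + 1) / √(n : ℝ) ∧ ((t : ℝ) + 1) / √(n : ℝ) ≤ q + η := by
  set a := q - η / 2 with ha
  set b := q + η / 4 with hb
  obtain ⟨γ, hγ, hγa, hγb⟩ : ∃ γ > 0, 3 * γ ≤ 1 - α - normCDF G a ∧
      3 * γ ≤ normCDF G b - (1 - α) := by
    refine ⟨min (1 - α - normCDF G a) (normCDF G b - (1 - α)) / 3,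
      div_pos (lt_min (by linarith) (by linarith)) (by norm_num), ?_, ?_⟩
    · linarith [min_le_left (1 - α - normCDF G a) (normCDF G b - (1 - α))]
    · linarith [min_le_right (1 - α - normCDF G a) (normCDF G b - (1 - α))]
  obtain ⟨K, hK, hKγ⟩ := exists_natCast_bound hγ
  have hpos' : ∀ᶠ n in atTop, 0 < n / m n := hpos.mono fun n h => by omega
  set D : (n : ℕ) → Set (Fin (m n) → 𝒳) := fun n =>
    badBoot θ (m n) n a (normCDF G a) γ ∪ badBoot θ (m n) n b (normCDF G b) γ ∪
      badNoise (ν n) θ (θt n) (m n) (η / 4) γ with hD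
  have hDm (n : ℕ) : MeasurableSet (D n) :=
    ((measurableSet_badBoot hθ _ _ _ _ _).union (measurableSet_badBoot hθ _ _ _ _ _)).union
      (measurableSet_badNoise hθ (hθt n) _ _ _)
  have hDlim : Tendsto (fun n => (Measure.pi fun _ : Fin (m n) => P) (D n)) atTop (𝓝 0) := by
    have h := ((tendsto_badBoot hθ hpos' hclt hks (hG a) hγ).add
      (tendsto_badBoot hθ hpos' hclt hks (hG b) hγ)).add
      (tendsto_badNoise hθ hθt hpos' hres (show 0 < η / 4 by linarith) hγ)
    rw [add_zero, add_zero] at h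
    refine tendsto_of_tendsto_of_tendsto_of_le_of_le tendsto_const_nhds h
      (fun n => zero_le) fun n => ?_
    exact (measure_union_le _ _).trans (add_le_add_left (measure_union_le _ _) _)
  refine ⟨fun n =>
    (fun p => p.2.2.2.2) ⁻¹' noiseEvent (n / m n) n ∪
    (fun p => (p.1, p.2.1)) ⁻¹'
      {p | n / m n / 16 + 1 ≤ count fun i => subsample p.2 p.1 i ∈ D n} ∪
    (fun p => (p.1, p.2.1, p.2.2.1)) ⁻¹' {p | ∃ t, n / m n / 16 + 1 ≤
      count (Deviates (ν n) θ (θt n) (N n) γ p.1 p.2.1 p.2.2 t)}, ?_, ?_⟩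
  · have hbound : Tendsto (fun n => ENNReal.ofReal (β n)
        + 16 * (Measure.pi fun _ : Fin (m n) => P) (D n) + ENNReal.ofReal (β n)) atTop (𝓝 0) := by
      have h1 : Tendsto (fun n => ENNReal.ofReal (β n)) atTop (𝓝 0) := by
        simpa using ENNReal.tendsto_ofReal hβ0
      have h2 := ENNReal.Tendsto.const_mul (a := 16) hDlim (Or.inr (by simp))
      simpa using (h1.add h2).add h1
    refine tendsto_of_tendsto_of_tendsto_of_le_of_le' tendsto_const_nhds hbound
      (Eventually.of_forall fun n => zero_le) ?_
    have hKN : ∀ᶠ n in atTop, (K : ℕ∞) < N n :=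
      hN.eventually (lt_mem_nhds (ENat.natCast_lt_top K))
    filter_upwards [hs, hpos', hKN, eventually_gt_atTop 0] with n hsn hn hKn hn0
    have hm : 0 < m n := Nat.pos_of_ne_zero fun h0 => by simp [h0] at hn
    obtain ⟨mp1, mp2, -, mp4⟩ := measurePreserving_runLaw P (ν n) (κ n) (N n) hm (hε n)
    refine (measure_union_le _ _).trans (add_le_add ((measure_union_le _ _).trans
      (add_le_add ?_ ?_)) ?_)
    · refine (mp4.measure_preimage_le _).trans (prod_noiseEvent_le (hε n) (hβ n) hn0 ?_)
      exact lt_of_le_of_lt (mul_le_mul_of_nonneg_left (le_max_left _ _) (by norm_num)) hsn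
    · exact (mp1.measure_preimage_le _).trans (prod_count_subsample_le (κ n) (hDm n))
    · refine (mp2.measure_preimage_le _).trans
        ((prod_deviates_le hm hθ (hθt n) (κ n) hγ hK hKn.le hKγ).trans
          (natCast_mul_inv_two_pow_le (hβ n) hn0 ?_))
      exact lt_of_le_of_lt (mul_le_mul_of_nonneg_left (le_max_right _ _) (by norm_num)) hsn
  · filter_upwards [hpos, exists_index hq hη] with n hn ht₁ p hp
    obtain ⟨t₁, ht₁, ht₁'⟩ := ht₁
    simp only [Set.mem_union, not_or, Set.mem_preimage, noiseEvent, Set.mem_ofPred_eq, not_lt,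
      not_exists, not_le] at hp
    obtain ⟨⟨⟨hx0, hx⟩, hcD⟩, hdev⟩ := hp
    obtain ⟨t, h1, h2, h3⟩ := exists_blbQuant (ν := ν n) (θt := θt n) (α := α) (γ := γ) (D := D n)
      (Outcome.ofTuple p) (by omega) hx0 hx hcD hdev
      (rej := fun t => ((t : ℝ) + 1) / √(n : ℝ) ≤ q - η) (t₁ := t₁)
      (fun t ht y hy => by
        simp only [hD, Set.mem_union, not_or] at hy
        have := privCov_le hy.1.1 hy.2 (I := ballSet d t) (fun u hu => hu)
          (show ((t : ℝ) + 1) / √(n : ℝ) + η / 4 ≤ a by linarith)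
        linarith)
      (fun y hy => by
        simp only [hD, Set.mem_union, not_or] at hy
        have := le_privCov hy.1.2 hy.2 (I := ballSet d t₁) (fun u hu => hu)
          (show b + η / 4 ≤ ((t₁ : ℝ) + 1) / √(n : ℝ) by linarith)
        linarith)
    refine ⟨t, h1, not_le.1 h3, le_trans ?_ ht₁'⟩
    have : (t : ℝ) ≤ t₁ := by exact_mod_cast h2
    gcongr

end

end PrivBLB

open PrivBLB

theorem mainTheorem6 {𝒳 𝒲 : Type*} [MeasurableSpace 𝒳] [MeasurableSpace 𝒲] {d : ℕ}
    (P : Measure 𝒳) [IsProbabilityMeasure P]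
    (ν : ℕ → Measure 𝒲) [∀ n, IsProbabilityMeasure (ν n)]
    (θ : Measure 𝒳 → EuclideanSpace ℝ (Fin d))
    (θt : (n : ℕ) → (Fin n → 𝒳) → 𝒲 → EuclideanSpace ℝ (Fin d))
    (hθ : ∀ n : ℕ, Measurable fun y : Fin n → 𝒳 => θ (PrivBLB.empirical y))
    (hθt : ∀ n : ℕ, Measurable (Function.uncurry (θt n)))
    (Sig : Matrix (Fin d) (Fin d) ℝ) (hSig : Sig.PosSemidef) (hSig0 : Sig ≠ 0)
    (α : ℝ) (hα0 : 0 < α) (hα1 : α < 1)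
    (m : ℕ → ℕ) (κ : (n : ℕ) → PMF (PrivBLB.Splitting n (m n)))
    (N : ℕ → ℕ∞) (hN : Tendsto N atTop (𝓝 ⊤))
    (ε β : ℕ → ℝ) (hε : ∀ n, 0 < ε n) (hβ : ∀ n, 0 < β n) (hβ0 : Tendsto β atTop (𝓝 0))
    (hs : ∀ᶠ n : ℕ in atTop,
      32 * max (1 / ε n * Real.log (8 * n / (3 * β n))) (Real.log (2 * n / β n))
        < ((n / m n : ℕ) : ℝ))
    (hclt : TendstoInDistribution (fun n : ℕ => PrivBLB.centered θ P n) atTop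
      (id : EuclideanSpace ℝ (Fin d) → EuclideanSpace ℝ (Fin d))
      (fun _ => PrivBLB.dataLaw P) (multivariateGaussian 0 Sig))
    (hks : PrivBLB.KSConsistent P θ m κ)
    (hres : PrivBLB.ResamplingConsistent P ν θ θt m κ)
    (Inone : ℕ → Set (EuclideanSpace ℝ (Fin d))) :
    Tendsto (fun n : ℕ =>
      (PrivBLB.runLaw P (ν n) n (m n) (κ n) (N n) (ε n)).real
        {p | θ P ∈ PrivBLB.confSet (ν n) θ (θt n) (N n) α (Inone n)
          (PrivBLB.Outcome.ofTuple p)})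
      atTop (𝓝 (1 - α)) := by
  set G := multivariateGaussian 0 Sig with hGdef
  have hG (r : ℝ) : G {v | ‖v‖ = r} = 0 := multivariateGaussian_norm_eq_null hSig hSig0 r
  obtain ⟨q, hq, hqτ⟩ := exists_normCDF_eq hG (τ := 1 - α) (by linarith) (by linarith)
  have hpos : ∀ᶠ n in atTop, 32 ≤ n / m n := by
    have h := eventually_le_numSubsamples (s := fun n => ((n / m n : ℕ) : ℝ)) hβ hβ0
      (hs.mono fun n hn => lt_of_le_of_lt
        (mul_le_mul_of_nonneg_left (le_max_right _ _) (by norm_num)) hn)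
    exact h.mono fun n hn => by exact_mod_cast hn
  have hF (r : ℝ) : Tendsto (fun n => (dataLaw P).real {x | ‖centered θ P n x‖ ≤ r}) atTop
      (𝓝 (normCDF G r)) := by
    have hF := hclt.tendsto
    simp only [Measure.map_id] at hF
    have h := tendsto_closedBall hF (hG r)
    refine h.congr fun n => ?_
    exact map_measureReal_apply (measurable_centered hθ n)
      (measurableSet_le measurable_norm measurable_const)
  -- the coverage probability is squeezed between two values of the limiting distribution function
  have key (η : ℝ) (hη : 0 < η) (hηq : η < q) : ∃ u : ℕ → ℝ, Tendsto u atTop (𝓝 0) ∧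
      ∀ᶠ n in atTop,
        (runLaw P (ν n) n (m n) (κ n) (N n) (ε n)).real
          {p | θ P ∈ confSet (ν n) θ (θt n) (N n) α (Inone n) (Outcome.ofTuple p)}
            ≤ (dataLaw P).real {x | ‖centered θ P n x‖ ≤ q + 2 * η} + u n ∧
        (dataLaw P).real {x | ‖centered θ P n x‖ ≤ q - 2 * η} - u n
          ≤ (runLaw P (ν n) n (m n) (κ n) (N n) (ε n)).real
            {p | θ P ∈ confSet (ν n) θ (θt n) (N n) α (Inone n) (Outcome.ofTuple p)} := by
    obtain ⟨B, hB, hloc⟩ := exists_localizing_event (α := α) (κ := κ) hθ hθt hG hq hη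
      (by rw [← hqτ]; exact normCDF_lt_normCDF hSig hSig0 (by linarith) (by linarith))
      (by rw [← hqτ]; exact normCDF_lt_normCDF hSig hSig0 (by linarith) (by linarith))
      hN hε hβ hβ0 hs hpos hclt hks hres
    set Err : (n : ℕ) → Set ((ℕ → 𝒳) × 𝒲) := fun n =>
      {r | η ≤ ‖√(n : ℝ) • (θt n (sample n r.1) r.2 - θ (empirical (sample n r.1)))‖} with hErr
    refine ⟨fun n => (((dataLaw P).prod (ν n)) (Err n)
      + runLaw P (ν n) n (m n) (κ n) (N n) (ε n) (B n)).toReal, ?_, ?_⟩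
    · have h := (hres.full η hη).add hB
      rw [add_zero] at h
      have h2 := (ENNReal.tendsto_toReal ENNReal.zero_ne_top).comp h
      rw [ENNReal.toReal_zero] at h2
      exact h2
    filter_upwards [hloc, hpos, eventually_gt_atTop 0] with n hn hn32 hn0
    have hm : 0 < m n := Nat.pos_of_ne_zero fun h0 => by simp [h0] at hn32
    have hprob := isProbabilityMeasure_runLaw P (ν n) (κ n) (N n) hm (hε n)
    obtain ⟨mp1, -, mp3, -⟩ := measurePreserving_runLaw P (ν n) (κ n) (N n) hm (hε n)
    set R := runLaw P (ν n) n (m n) (κ n) (N n) (ε n)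
    have hsmall : R.real ((fun p => (p.1, p.2.2.2.1)) ⁻¹' Err n ∪ B n)
        ≤ (((dataLaw P).prod (ν n)) (Err n) + R (B n)).toReal := by
      refine ENNReal.toReal_mono (by finiteness) ((measure_union_le _ _).trans ?_)
      gcongr
      exact mp3.measure_preimage_le _
    have hdata (r : ℝ) : R.real {p | ‖centered θ P n p.1‖ ≤ r}
        = (dataLaw P).real {x | ‖centered θ P n x‖ ≤ r} := by
      have hmeas : MeasurableSet {x | ‖centered θ P n x‖ ≤ r} :=
        measurableSet_le (measurable_centered hθ n).norm measurable_const
      exact (measurePreserving_fst.comp mp1).measureReal_preimage hmeas.nullMeasurableSet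
    have hdecomp (x : ℕ → 𝒳) (w : 𝒲) : centered θ P n x = √(n : ℝ) • (θ P - θt n (sample n x) w)
        + √(n : ℝ) • (θt n (sample n x) w - θ (empirical (sample n x))) := by
      unfold centered
      rw [← smul_add]
      congr 1
      abel
    constructor
    · rw [← hdata]
      refine le_trans ?_ (add_le_add_right hsmall _)
      refine (measureReal_mono ?_).trans (measureReal_union_le _ _)
      intro p hp
      by_cases hbad : p ∈ (fun p => (p.1, p.2.2.2.1)) ⁻¹' Err n ∪ B n
      · exact Or.inr hbad
      · left
        simp only [Set.mem_union, not_or, Set.mem_preimage, hErr, Set.mem_ofPred_eq, not_le] at hbad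
        obtain ⟨t, ht, ht1, ht2⟩ := hn p hbad.2
        have h1 := (mem_confSet_iff hn0 ht).1 hp
        change ‖centered θ P n p.1‖ ≤ _
        rw [hdecomp p.1 p.2.2.2.1]
        refine (norm_add_le _ _).trans ?_
        have h2 : ‖√(n : ℝ) • (θ P - θt n (sample n p.1) p.2.2.2.1)‖ ≤ ((t : ℝ) + 1) / √(n : ℝ) :=
          h1
        linarith [hbad.1]
    · rw [← hdata, sub_le_iff_le_add]
      refine le_trans ?_ (add_le_add_right hsmall _)
      refine (measureReal_mono ?_).trans (measureReal_union_le _ _)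
      intro p hp
      by_cases hbad : p ∈ (fun p => (p.1, p.2.2.2.1)) ⁻¹' Err n ∪ B n
      · exact Or.inr hbad
      · left
        simp only [Set.mem_union, not_or, Set.mem_preimage, hErr, Set.mem_ofPred_eq, not_le] at hbad
        obtain ⟨t, ht, ht1, ht2⟩ := hn p hbad.2
        refine (mem_confSet_iff hn0 ht).2 ?_
        have hp' : ‖centered θ P n p.1‖ ≤ q - 2 * η := hp
        change ‖√(n : ℝ) • (θ P - θt n (sample n p.1) p.2.2.2.1)‖ ≤ _
        rw [eq_sub_of_add_eq (hdecomp p.1 p.2.2.2.1).symm]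
        refine (norm_sub_le _ _).trans ?_
        linarith [hbad.1]
  have hcont := continuous_normCDF hG
  have hsmallη : ∀ᶠ η in 𝓝[>] (0 : ℝ), 0 < η ∧ η < q := by
    filter_upwards [self_mem_nhdsWithin, nhdsWithin_le_nhds (gt_mem_nhds hq)] with η h1 h2
    exact ⟨h1, h2⟩
  have hlim (c : ℝ) : Tendsto (fun η => normCDF G (q + c * η)) (𝓝[>] 0) (𝓝 (1 - α)) := by
    have h : Continuous fun η => normCDF G (q + c * η) := by fun_prop
    have h' := h.tendsto 0
    simp only [mul_zero, add_zero, hqτ] at h'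
    exact h'.mono_left nhdsWithin_le_nhds
  refine tendsto_order.2 ⟨fun l hl => ?_, fun l hl => ?_⟩
  · obtain ⟨η, ⟨hη, hηq⟩, h⟩ := (hsmallη.and ((hlim (-2)).eventually (lt_mem_nhds hl))).exists
    obtain ⟨u, hu, hev⟩ := key η hη hηq
    have h2 := (hF (q - 2 * η)).sub hu
    rw [sub_zero] at h2
    have h3 : l < normCDF G (q - 2 * η) := by rwa [sub_eq_add_neg, ← neg_mul]
    filter_upwards [hev, h2.eventually (lt_mem_nhds h3)] with n hn hn2
    exact hn2.trans_le hn.2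
  · obtain ⟨η, ⟨hη, hηq⟩, h⟩ := (hsmallη.and ((hlim 2).eventually (gt_mem_nhds hl))).exists
    obtain ⟨u, hu, hev⟩ := key η hη hηq
    have h2 := (hF (q + 2 * η)).add hu
    rw [add_zero] at h2
    filter_upwards [hev, h2.eventually (gt_mem_nhds h)] with n hn hn2
    exact hn.1.trans_lt hn2
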